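/- **Setting.** Let $(M,d)$ be a complete separable metric space, $m$ a Radon measure on $M$, and $p\in(1,\infty)$. Fix $\overline R\in(0,\operatorname{diam}(M,d)]$ (possibly $\infty$ if $\operatorname{diam}(M,d)=\infty$) and a *scale function* $W:M\times[0,\infty)\to[0,\infty)$: for every $x$, $W(x,\cdot)$ is strictly increasing with $W(x,0)=0$ and $\lim_{R\to\infty}W(x,R)=\infty$, and there are $C\ge 1$, $0<\beta_1\le\beta_2<\infty$ with $$C^{-1}\Big(\frac Rr\Big)^{\beta_1}\le\frac{W(x,R)}{W(y,r)}\le C\Big(\frac Rr\Big)^{\beta_2}\qquad\text{whenever } 0<r\le R<\infty,\ d(x,y)\le R .$$ For a ball $B=B(x,r)=\{y: d(x,y)<r\}$, $r>0$, write $W(B)=W(x,r)$. $C_c(M)$ denotes the continuous functions with compact support. **Energy forms.** A *$p$-energy form* $(\mathcal E,\mathcal F)$ consists of a linear subspace $\mathcal F\subset L^p(M,m)$ and $\mathcal E:\mathcal F\to[0,\infty)$ such that $\mathcal E^{1/p}$ is a seminorm. Put $\mathcal E_1(u)=\mathcal E(u)+\|u\|_{L^p}^p$. The form is * *closed* if $(\mathcal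 F,\mathcal E_1^{1/p})$ is complete; * *regular* if $\mathcal F\cap C_c(M)$ is dense in $(\mathcal F,\mathcal E_1^{1/p})$ and in $(C_c(M),\|\cdot\|_{\sup})$; * *strongly sub-additive* if for all $u,v\in\mathcal F$: $u\wedge v,u\vee v\in\mathcal F$ and $\mathcal E(u\wedge v)+\mathcal E(u\vee v)\le\mathcal E(u)+\mathcal E(v)$; * *Markovian* if $\psi\circ u\in\mathcal F$ and $\mathcal E(\psi\circ u)\le\mathcal E(u)$ for all $u\in\mathcal F$ and all $1$-Lipschitz $\psi:\mathbb R\to\mathbb R$ with $\psi(0)=0$; * *strongly local* if $\mathcal E(u+v)=\mathcal E(u)+\mathcal E(v)$ whenever $u,v\in\mathcal F$, $\operatorname{supp}_m(u)$ and $\operatorname{supp}_m(v)$ are compact and $\operatorname{supp}_m(u)\cap\operatorname{supp}_m(v+a)=\emptyset$ for some $a\in\mathbb R$, where $\operatorname{supp}_m(f)$ is the support of the measure $|f|\,dm$; * said to satisfy the *$p$-Clarkson inequality* if for all $u,v\in\mathcal F$, $\mathcal E(u+v)+\mathcal E(u-v)\ge 2\big(\mathcal E(u)^{1/(p-1)}+\mathcal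 E(v)^{1/(p-1)}\big)^{p-1}$ in case $p\le2$, and the reverse inequality holds in case $p\ge2$. Let $M^2_{\mathrm{od}}=\{(x,y)\in M\times M: x\ne y\}$. A measure $j$ on $M^2_{\mathrm{od}}$ is *symmetric* if $\int f(x)g(y)\,dj=\int f(y)g(x)\,dj\in[0,\infty]$ for all nonnegative $f,g\in C_c(M)$. $(\mathcal E,\mathcal F)$ is a *mixed local and nonlocal $p$-energy form* if it is a closed, regular, strongly sub-additive $p$-energy form and there is a symmetric Radon measure $j$ on $M^2_{\mathrm{od}}$ such that $$\mathcal E^{(L)}(u)=\mathcal E(u)-\int_{M^2_{\mathrm{od}}}|u(x)-u(y)|^p\,dj(x,y),\qquad u\in\mathcal F\cap C_c(M),$$ defines a strongly local $p$-energy form $(\mathcal E^{(L)},\mathcal F\cap C_c(M))$ that is Markovian and satisfies the $p$-Clarkson inequality. **The spaces $\mathcal F(\Omega)$.** For $A$ open let $\operatorname{Cap}_1(A)=\inf\{\mathcal E_1(u):u\in\mathcal F,\ u\ge1\ m\text{-a.e. on }A\}$ (with $\inf\emptyset=\infty$), and for arbitrary $A$ let $\operatorname{Cap}_1(A)=\inf\{\operatorname{Cap}_1(G):G\supset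 A\text{ open}\}$. A property holds *quasi-everywhere* on $A$ if it holds on $A\setminus N$ for some Borel $N\subset A$ with $\operatorname{Cap}_1(N)=0$. A function $f$ on $M$ is *quasi-continuous* if for every $\epsilon>0$ there is an open $G$ with $\operatorname{Cap}_1(G)<\epsilon$ such that $f|_{M\setminus G}$ is finite-valued and continuous. For $\Omega\subset M$ open, $\mathcal F(\Omega)$ is the set of $u\in\mathcal F$ having a quasi-continuous $m$-version $\widetilde u$ with $\widetilde u=0$ quasi-everywhere on $M\setminus\Omega$. **Inequalities.** All three are read in $[0,\infty]$, with $0\cdot\infty=0$, $0/0=0$, $\infty/\infty=0$ and $a/0=\infty$ for $a>0$. * (FK) There are $\sigma\in(0,1]$, $C\in(0,\infty)$, $\nu\in(0,\infty)$ such that for every ball $B=B(x,r)$ with $0<r<\sigma\overline R$ and every non-empty open $\Omega\subset B$, $$\mathcal E(u)\ge\frac{C}{W(B)}\Big(\frac{m(B)}{m(\Omega)}\Big)^{\nu}\|u\|_{L^p(\Omega,m)}^p\qquad\forall u\in\mathcal F(\Omega).$$ * (SI) There are $\sigma\in(0,1]$, $C\in(0,\infty)$, $\nu\in(0,1)$ such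 that for every ball $B=B(x,r)$ with $0<r<\sigma\overline R$, $$\mathcal E(u)\ge C\,\frac{m(B)^{\nu}}{W(B)}\|u\|_{L^{p/(1-\nu)}(B,m)}^p\qquad\forall u\in\mathcal F(B).$$ * (STI) There are $\sigma\in(0,1]$, $C\in(0,\infty)$, $\nu\in(0,\infty)$ such that for every ball $B=B(x,r)$ with $0<r<\sigma\overline R$, $$\int_B|u|^{p(1+\nu)}\,dm\le C\,\frac{W(B)}{m(B)^{\nu}}\,\mathcal E(u)\Big(\int_B|u|^p\,dm\Big)^{\nu}\qquad\forall u\in\mathcal F(B).$$ **Theorem.** Let $(\mathcal E,\mathcal F)$ be a mixed local and nonlocal $p$-energy form on $(M,d,m)$. Then $$(\mathrm{FK})\iff(\mathrm{SI})\iff(\mathrm{STI}).$$ -/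

import Mathlib

open MeasureTheory Filter Topology
open scoped ENNReal

noncomputable section

namespace PEnergy

/-- The space `L^p(M, m)` for a real exponent `p`. -/
abbrev LpSpace {M : Type*} [MeasurableSpace M] (m : Measure M) (p : ℝ) : Type _ :=
  Lp ℝ (ENNReal.ofReal p) m

section Basic

variable {M : Type*} [MeasurableSpace M] {m : Measure M} {p : ℝ}

/-! A form `(E, F)` is given by a linear subspace `F` of `L^p(M, m)` and a function `E` on
`L^p(M, m)`; only the values of `E` on `F` are ever used. -/

/-- `(E, F)` is a `p`-energy form: `E ≥ 0` on `F` and `E^{1/p}` is a seminorm on `F`. -/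
structure IsEnergyForm (F : Submodule ℝ (LpSpace m p)) (E : LpSpace m p → ℝ) : Prop where
  nonneg : ∀ u ∈ F, 0 ≤ E u
  smul : ∀ (a : ℝ), ∀ u ∈ F, E (a • u) ^ (1 / p) = |a| * E u ^ (1 / p)
  add_le : ∀ u ∈ F, ∀ v ∈ F, E (u + v) ^ (1 / p) ≤ E u ^ (1 / p) + E v ^ (1 / p)

/-- `E_1(u) = E(u) + ‖u‖_{L^p}^p`. -/
def E1 (E : LpSpace m p → ℝ) (u : LpSpace m p) : ℝ := E u + ‖u‖ ^ p

/-- The form is closed: `(F, E_1^{1/p})` is complete (every Cauchy sequence converges). -/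
def Closed (F : Submodule ℝ (LpSpace m p)) (E : LpSpace m p → ℝ) : Prop :=
  ∀ u : ℕ → LpSpace m p, (∀ n, u n ∈ F) →
    (∀ ε > 0, ∃ N, ∀ n ≥ N, ∀ k ≥ N, E1 E (u n - u k) < ε) →
    ∃ v ∈ F, Tendsto (fun n => E1 E (u n - v)) atTop (𝓝 0)

/-- Strong sub-additivity. -/
def StrongSub (F : Submodule ℝ (LpSpace m p)) (E : LpSpace m p → ℝ) : Prop :=
  ∀ u ∈ F, ∀ v ∈ F, u ⊓ v ∈ F ∧ u ⊔ v ∈ F ∧ E (u ⊓ v) + E (u ⊔ v) ≤ E u + E v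

/-- The Markovian property: `F` is stable under every `1`-Lipschitz `ψ` with `ψ 0 = 0`, and such
`ψ` do not increase the energy. -/
def Markovian (F : Submodule ℝ (LpSpace m p)) (E : LpSpace m p → ℝ) : Prop :=
  ∀ (ψ : ℝ → ℝ) (hψ : LipschitzWith 1 ψ) (h0 : ψ 0 = 0), ∀ u ∈ F,
    hψ.compLp h0 u ∈ F ∧ E (hψ.compLp h0 u) ≤ E u

/-- The `p`-Clarkson inequality. -/
def Clarkson (F : Submodule ℝ (LpSpace m p)) (E : LpSpace m p → ℝ) : Prop :=
  ∀ u ∈ F, ∀ v ∈ F,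
    (p ≤ 2 → 2 * (E u ^ (1 / (p - 1)) + E v ^ (1 / (p - 1))) ^ (p - 1) ≤ E (u + v) + E (u - v)) ∧
    (2 ≤ p → E (u + v) + E (u - v) ≤ 2 * (E u ^ (1 / (p - 1)) + E v ^ (1 / (p - 1))) ^ (p - 1))

end Basic

section Metric

variable {M : Type*} [MetricSpace M] [MeasurableSpace M] {m : Measure M} {p : ℝ}

/-- `supp_m(f)`: the support of the measure `|f| dm`. -/
def msupp (m : Measure M) (f : M → ℝ) : Set M := (m.withDensity fun x => ‖f x‖ₑ).support

/-- Strong locality. -/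
def StronglyLocal (F : Submodule ℝ (LpSpace m p)) (E : LpSpace m p → ℝ) : Prop :=
  ∀ u ∈ F, ∀ v ∈ F, IsCompact (msupp m u) → IsCompact (msupp m v) →
    (∃ a : ℝ, Disjoint (msupp m u) (msupp m fun x => v x + a)) → E (u + v) = E u + E v

/-- The elements of `L^p(M, m)` that have a continuous, compactly supported version. -/
def CcLp (m : Measure M) (p : ℝ) : Submodule ℝ (LpSpace m p) where
  carrier := {u | ∃ f : M → ℝ, Continuous f ∧ HasCompactSupport f ∧ u =ᵐ[m] f}
  zero_mem' := ⟨0, continuous_zero, HasCompactSupport.zero, Lp.coeFn_zero _ _ _⟩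
  add_mem' := by
    rintro u v ⟨f, hf, hf', huf⟩ ⟨g, hg, hg', hvg⟩
    exact ⟨f + g, hf.add hg, hf'.add hg', (Lp.coeFn_add u v).trans (huf.add hvg)⟩
  smul_mem' := by
    rintro c u ⟨f, hf, hf', huf⟩
    exact ⟨c • f, hf.const_smul c, hf'.smul_left (f := fun _ => c),
      (Lp.coeFn_smul c u).trans (huf.const_smul c)⟩

/-- The form is regular: `F ∩ C_c(M)` is dense in `(F, E_1^{1/p})` and in `C_c(M)` with the
supremum norm. -/
def Regular (F : Submodule ℝ (LpSpace m p)) (E : LpSpace m p → ℝ) : Prop :=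
  (∀ u ∈ F, ∀ ε > 0, ∃ v ∈ F ⊓ CcLp m p, E1 E (u - v) < ε) ∧
  (∀ f : M → ℝ, Continuous f → HasCompactSupport f → ∀ ε > 0,
    ∃ g : M → ℝ, Continuous g ∧ HasCompactSupport g ∧ (∃ v ∈ F, v =ᵐ[m] g) ∧
      ∀ x, |f x - g x| < ε)

/-- The off-diagonal `M × M ∖ {(x, x)}`, an open subspace of `M × M`. -/
abbrev OffDiag (M : Type*) : Type _ := {q : M × M // q.1 ≠ q.2}

/-- Symmetry of a measure on the off-diagonal:
`∫ f(x) g(y) dj = ∫ f(y) g(x) dj` for `f, g ∈ C_c(M)`. The integrals are taken in `[0, ∞]`, for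
nonnegative `f, g`, since `j` may be infinite near the diagonal. -/
def SymmMeasure (j : Measure (OffDiag M)) : Prop :=
  ∀ f g : M → ℝ, Continuous f → HasCompactSupport f → Continuous g → HasCompactSupport g →
    (∀ x, 0 ≤ f x) → (∀ x, 0 ≤ g x) →
    ∫⁻ q, ENNReal.ofReal (f q.1.1 * g q.1.2) ∂j = ∫⁻ q, ENNReal.ofReal (f q.1.2 * g q.1.1) ∂j

/-- `∫ |f(x) - f(y)|^p dj(x, y)`, with value in `[0, ∞]`. -/
def jumpEnergy (p : ℝ) (j : Measure (OffDiag M)) (f : M → ℝ) : ℝ≥0∞ :=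
  ∫⁻ q, ENNReal.ofReal (|f q.1.1 - f q.1.2| ^ p) ∂j

/-- `(E, F)` is a mixed local and nonlocal `p`-energy form on `(M, m)`. -/
structure IsMixedForm (F : Submodule ℝ (LpSpace m p)) (E : LpSpace m p → ℝ) : Prop where
  isEnergyForm : IsEnergyForm F E
  closed : Closed F E
  regular : Regular F E
  strongSub : StrongSub F E
  /-- There is a symmetric Radon measure `j` on the off-diagonal such that
  `EL(u) = E(u) - ∫ |u(x) - u(y)|^p dj`, for `u ∈ F ∩ C_c(M)`, defines a strongly local
  `p`-energy form on `F ∩ C_c(M)` that is Markovian and satisfies the `p`-Clarkson inequality. -/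
  exists_jump : ∃ (j : Measure (OffDiag M)) (EL : LpSpace m p → ℝ),
    j.Regular ∧ SymmMeasure j ∧
    (∀ u ∈ F, ∀ f : M → ℝ, Continuous f → HasCompactSupport f → u =ᵐ[m] f →
      jumpEnergy p j f ≠ ∞ ∧ EL u = E u - (jumpEnergy p j f).toReal) ∧
    IsEnergyForm (F ⊓ CcLp m p) EL ∧ StronglyLocal (F ⊓ CcLp m p) EL ∧
    Markovian (F ⊓ CcLp m p) EL ∧ Clarkson (F ⊓ CcLp m p) EL

/-- The capacity of an open set: the infimum of `E_1(u)` over `u ∈ F` with `u ≥ 1` a.e. on `A`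
(and `∞` if there is no such `u`). -/
def capOpen (F : Submodule ℝ (LpSpace m p)) (E : LpSpace m p → ℝ) (A : Set M) : ℝ≥0∞ :=
  ⨅ u ∈ {u : LpSpace m p | u ∈ F ∧ ∀ᵐ x ∂m.restrict A, 1 ≤ u x}, ENNReal.ofReal (E1 E u)

/-- The capacity of an arbitrary set: the infimum of the capacities of its open supersets. -/
def cap (F : Submodule ℝ (LpSpace m p)) (E : LpSpace m p → ℝ) (A : Set M) : ℝ≥0∞ :=
  ⨅ G ∈ {G : Set M | IsOpen G ∧ A ⊆ G}, capOpen F E G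

/-- `P` holds quasi-everywhere on `A`. -/
def QEOn (F : Submodule ℝ (LpSpace m p)) (E : LpSpace m p → ℝ) (A : Set M) (P : M → Prop) : Prop :=
  ∃ N ⊆ A, MeasurableSet N ∧ cap F E N = 0 ∧ ∀ x ∈ A \ N, P x

/-- Quasi-continuity of a function on `M`. -/
def QuasiContinuous (F : Submodule ℝ (LpSpace m p)) (E : LpSpace m p → ℝ) (f : M → ℝ) : Prop :=
  ∀ ε : ℝ≥0∞, 0 < ε → ∃ G : Set M, IsOpen G ∧ capOpen F E G < ε ∧ ContinuousOn f Gᶜ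

/-- The subspace `F(Ω)` of all `u ∈ F` whose quasi-continuous version vanishes
quasi-everywhere on `M ∖ Ω`. -/
def Dom (F : Submodule ℝ (LpSpace m p)) (E : LpSpace m p → ℝ) (Ω : Set M) : Set (LpSpace m p) :=
  {u | u ∈ F ∧ ∃ f : M → ℝ, QuasiContinuous F E f ∧ u =ᵐ[m] f ∧ QEOn F E Ωᶜ fun x => f x = 0}

/-- `W` (restricted to `M × [0, ∞)`) is a scale function. -/
structure IsScale (W : M → ℝ → ℝ) : Prop where
  strictMonoOn : ∀ x, StrictMonoOn (W x) (Set.Ici 0)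
  zero : ∀ x, W x 0 = 0
  tendsto : ∀ x, Tendsto (W x) atTop atTop
  bounds : ∃ C β₁ β₂ : ℝ, 1 ≤ C ∧ 0 < β₁ ∧ β₁ ≤ β₂ ∧
    ∀ (x y : M) (r R : ℝ), 0 < r → r ≤ R → dist x y ≤ R →
      C⁻¹ * (R / r) ^ β₁ ≤ W x R / W y r ∧ W x R / W y r ≤ C * (R / r) ^ β₂

/-! The three inequalities are read in `[0, ∞]`. -/

/-- The Faber–Krahn inequality. -/
def FaberKrahn (F : Submodule ℝ (LpSpace m p)) (E : LpSpace m p → ℝ) (W : M → ℝ → ℝ)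
    (Rbar : ℝ≥0∞) : Prop :=
  ∃ σ C ν : ℝ, 0 < σ ∧ σ ≤ 1 ∧ 0 < C ∧ 0 < ν ∧
    ∀ (x : M) (r : ℝ), 0 < r → ENNReal.ofReal r < ENNReal.ofReal σ * Rbar →
    ∀ Ω : Set M, IsOpen Ω → Ω.Nonempty → Ω ⊆ Metric.ball x r →
    ∀ u ∈ Dom F E Ω,
      ENNReal.ofReal (C / W x r) * (m (Metric.ball x r) / m Ω) ^ ν *
          eLpNorm u (ENNReal.ofReal p) (m.restrict Ω) ^ p
        ≤ ENNReal.ofReal (E u)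

/-- The Sobolev inequality, with exponent `p / (1 - ν)`. -/
def Sobolev (F : Submodule ℝ (LpSpace m p)) (E : LpSpace m p → ℝ) (W : M → ℝ → ℝ)
    (Rbar : ℝ≥0∞) : Prop :=
  ∃ σ C ν : ℝ, 0 < σ ∧ σ ≤ 1 ∧ 0 < C ∧ 0 < ν ∧ ν < 1 ∧
    ∀ (x : M) (r : ℝ), 0 < r → ENNReal.ofReal r < ENNReal.ofReal σ * Rbar →
    ∀ u ∈ Dom F E (Metric.ball x r),
      ENNReal.ofReal (C / W x r) * m (Metric.ball x r) ^ ν *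
          eLpNorm u (ENNReal.ofReal (p / (1 - ν))) (m.restrict (Metric.ball x r)) ^ p
        ≤ ENNReal.ofReal (E u)

/-- The Sobolev-type inequality. -/
def SobolevType (F : Submodule ℝ (LpSpace m p)) (E : LpSpace m p → ℝ) (W : M → ℝ → ℝ)
    (Rbar : ℝ≥0∞) : Prop :=
  ∃ σ C ν : ℝ, 0 < σ ∧ σ ≤ 1 ∧ 0 < C ∧ 0 < ν ∧
    ∀ (x : M) (r : ℝ), 0 < r → ENNReal.ofReal r < ENNReal.ofReal σ * Rbar →
    ∀ u ∈ Dom F E (Metric.ball x r),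
      ∫⁻ y in Metric.ball x r, ENNReal.ofReal (|u y| ^ (p * (1 + ν))) ∂m
        ≤ ENNReal.ofReal (C * W x r) / m (Metric.ball x r) ^ ν * ENNReal.ofReal (E u) *
          (∫⁻ y in Metric.ball x r, ENNReal.ofReal (|u y| ^ p) ∂m) ^ ν

end Metric

end PEnergy

end

/-!
The three inequalities are proved in the cycle Faber–Krahn ⇒ Sobolev ⇒ Sobolev-type ⇒ Faber–Krahn.
The exponent `ν` may change along the way, and this is what makes a single truncation at a time
sufficient: no decomposition of the energy over a sequence of truncations is needed.

The last two implications are Hölder's inequality. The second of them also uses that a function of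
`F(Ω)` vanishes almost everywhere outside `Ω`, as sets of capacity zero are null sets.

For the first one, let `u ∈ F(B)`. The truncation `(|u| - t)⁺` belongs to `F(Ω)` for an open
`Ω ⊆ B` of measure barely larger than `b(t) = m(B ∩ {|u| > t})` (`exists_isOpen_trunc_mem_Dom`), and
its energy is at most `E(u)`. Faber–Krahn and Chebyshev's inequality give
`t ^ p * b(2t) ≤ A * b(t) ^ ν` with `A` proportional to `W(B) E(u) / m(B) ^ ν`. Since `ν` may be
taken less than `1`, this relation improves itself to the weak-type bound
`b(t) ≤ D * t ^ (-p / (1 - ν))` (`rpow_mul_le_of_doubling`). On a ball of finite measure the weak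
bound controls the strong norm for any smaller exponent (`lintegral_rpow_le_of_weak`), which is the
Sobolev inequality with `ν / 2`. On a ball of infinite measure Faber–Krahn forces `u = 0`.

That truncations do not increase the energy is the Markov property of `E` on all of `F`
(`IsMixedForm.markovian`). On `F ∩ C_c(M)` it is read off from the decomposition into the strongly
local part and the jump part (`IsMixedForm.markovian_inf`). It extends by density because
`E` is lower semicontinuous along `L ^ p`-convergent sequences of bounded energy
(`IsEnergyForm.mem_and_le_of_tendsto`). The latter rests on uniform convexity, for which the
form `UnifConvex` is used: it follows from the Clarkson inequality for the strongly local part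
(`Clarkson.unifConvex`), from a pointwise inequality for the jump part
(`exists_jumpEnergy_sub_le`), and it passes to the sum.
-/

namespace PEnergy

/-! ### Convexity of powers -/

lemma rpow_midpoint_le {r x y : ℝ} (hr : 1 ≤ r) (hx : 0 ≤ x) (hy : 0 ≤ y) :
    ((x + y) / 2) ^ r ≤ (x ^ r + y ^ r) / 2 := by
  have h := (convexOn_rpow hr).2 (Set.mem_Ici.2 hx) (Set.mem_Ici.2 hy)
    (by norm_num : (0 : ℝ) ≤ 1 / 2) (by norm_num : (0 : ℝ) ≤ 1 / 2) (by norm_num)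
  simp only [smul_eq_mul] at h
  calc ((x + y) / 2) ^ r = (1 / 2 * x + 1 / 2 * y) ^ r := by congr 1; ring
    _ ≤ _ := h
    _ = _ := by ring

lemma abs_rpow_midpoint_lt {p s t : ℝ} (hp : 1 < p) (hst : s ≠ t) :
    |(s + t) / 2| ^ p < (|s| ^ p + |t| ^ p) / 2 := by
  have habs : |(s + t) / 2| ≤ (|s| + |t|) / 2 := by
    rw [abs_div, abs_two]; gcongr; exact abs_add_le s t
  by_cases h : |s| = |t|
  · obtain rfl : s = -t := (abs_eq_abs.1 h).resolve_left hst
    have ht : t ≠ 0 := by rintro rfl; simp at hst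
    have : 0 < |t| ^ p := Real.rpow_pos_of_pos (abs_pos.2 ht) p
    simpa [Real.zero_rpow (by linarith : p ≠ 0)] using this
  · have h' := (strictConvexOn_rpow hp).2 (Set.mem_Ici.2 (abs_nonneg s))
      (Set.mem_Ici.2 (abs_nonneg t)) h (by norm_num : (0 : ℝ) < 1 / 2)
      (by norm_num : (0 : ℝ) < 1 / 2) (by norm_num)
    simp only [smul_eq_mul] at h'
    calc |(s + t) / 2| ^ p ≤ (1 / 2 * |s| + 1 / 2 * |t|) ^ p := by
          refine Real.rpow_le_rpow (abs_nonneg _) (habs.trans_eq (by ring)) (by linarith)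
      _ < _ := h'
      _ = _ := by ring

lemma abs_rpow_midpoint_le {p : ℝ} (hp : 1 < p) (s t : ℝ) :
    |(s + t) / 2| ^ p ≤ (|s| ^ p + |t| ^ p) / 2 := by
  rcases eq_or_ne s t with rfl | h
  · simp
  · exact (abs_rpow_midpoint_lt hp h).le

/-- Quantitative strict convexity of `|x| ^ p`. By homogeneity it is enough to treat the unit
sphere of `ℝ × ℝ`, where it follows from compactness. -/
lemma exists_abs_sub_rpow_le {p : ℝ} (hp : 1 < p) {ε : ℝ} (hε : 0 < ε) :
    ∃ C : ℝ, 0 ≤ C ∧ ∀ s t : ℝ, |s - t| ^ p ≤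
      ε * (|s| ^ p + |t| ^ p) + C * ((|s| ^ p + |t| ^ p) / 2 - |(s + t) / 2| ^ p) := by
  have hp0 : 0 ≤ p := by linarith
  have hcont : ∀ f : ℝ × ℝ → ℝ, Continuous f → Continuous fun z => |f z| ^ p := fun f hf =>
    hf.abs.rpow_const fun _ => Or.inr hp0
  set num : ℝ × ℝ → ℝ := fun z => |z.1 - z.2| ^ p - ε * (|z.1| ^ p + |z.2| ^ p) with hnum
  set gap : ℝ × ℝ → ℝ := fun z => (|z.1| ^ p + |z.2| ^ p) / 2 - |(z.1 + z.2) / 2| ^ p with hgap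
  have hnumc : Continuous num := by
    have h1 := hcont _ (continuous_fst.sub continuous_snd)
    have h2 := hcont _ continuous_fst
    have h3 := hcont _ continuous_snd
    exact h1.sub (continuous_const.mul (h2.add h3))
  have hgapc : Continuous gap := by
    have h1 := hcont (fun z => (z.1 + z.2) / 2) (by fun_prop)
    have h2 := hcont _ continuous_fst
    have h3 := hcont _ continuous_snd
    exact ((h2.add h3).div_const 2).sub h1
  have hgap0 : ∀ z, 0 ≤ gap z := fun z => sub_nonneg.2 (abs_rpow_midpoint_le hp z.1 z.2)
  -- The part of the unit sphere where the error term alone does not suffice.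
  set K : Set (ℝ × ℝ) := Metric.sphere 0 1 ∩ {z | 0 ≤ num z} with hK
  have hKc : IsCompact K :=
    (isCompact_sphere 0 1).inter_right (isClosed_le continuous_const hnumc)
  have hKpos : ∀ z ∈ K, 0 < gap z := by
    rintro ⟨s, t⟩ ⟨hz, hz'⟩
    refine sub_pos.2 (abs_rpow_midpoint_lt hp ?_)
    intro hst
    obtain rfl : s = t := hst
    have hs : |s| = 1 := by simpa [Prod.norm_def] using hz
    have : 0 ≤ num (s, s) := hz'
    simp only [hnum, sub_self, abs_zero, Real.zero_rpow (by linarith : p ≠ 0), hs,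
      Real.one_rpow] at this
    linarith
  obtain ⟨C, hC0, hC⟩ : ∃ C : ℝ, 0 ≤ C ∧ ∀ z ∈ Metric.sphere (0 : ℝ × ℝ) 1,
      num z ≤ C * gap z := by
    rcases K.eq_empty_or_nonempty with hE | hne
    · refine ⟨0, le_rfl, fun z hz => ?_⟩
      by_contra! h
      have : z ∈ K := ⟨hz, by simpa using h.le⟩
      simp [hE] at this
    · obtain ⟨z₀, hz₀, hmin⟩ := hKc.exists_isMinOn hne hgapc.continuousOn
      obtain ⟨z₁, hz₁, hmax⟩ := hKc.exists_isMaxOn hne hnumc.continuousOn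
      have h0 := hKpos z₀ hz₀
      have h1 : 0 ≤ num z₁ := hz₁.2
      refine ⟨num z₁ / gap z₀, by positivity, fun z hz => ?_⟩
      by_cases h : 0 ≤ num z
      · have hzK : z ∈ K := ⟨hz, h⟩
        calc num z ≤ num z₁ := hmax hzK
          _ = num z₁ / gap z₀ * gap z₀ := by field_simp
          _ ≤ _ := by gcongr; exact hmin hzK
      · have := hgap0 z
        have : 0 ≤ num z₁ / gap z₀ * gap z := by positivity
        linarith
  refine ⟨C, hC0, fun s t => ?_⟩
  suffices h : num (s, t) ≤ C * gap (s, t) by simp only [hnum, hgap] at h; linarith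
  by_cases hz : (s, t) = (0 : ℝ × ℝ)
  · simp only [Prod.mk_eq_zero] at hz
    simp [hnum, hgap, hz.1, hz.2, Real.zero_rpow (by linarith : p ≠ 0)]
  set l := ‖(s, t)‖ with hl
  have hlpos : 0 < l := norm_pos_iff.2 hz
  have key : ∀ x : ℝ, |x| ^ p = l ^ p * |x / l| ^ p := fun x => by
    rw [abs_div, abs_of_pos hlpos, Real.div_rpow (abs_nonneg x) hlpos.le]
    field_simp
  have hunit : (s / l, t / l) ∈ Metric.sphere (0 : ℝ × ℝ) 1 := by
    have : (s / l, t / l) = l⁻¹ • (s, t) := by ext <;> simp [div_eq_inv_mul]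
    rw [mem_sphere_zero_iff_norm, this, norm_smul, ← hl, norm_inv, Real.norm_of_nonneg hlpos.le]
    field_simp
  have e1 : num (s, t) = l ^ p * num (s / l, t / l) := by
    simp only [hnum]
    rw [key (s - t), key s, key t, sub_div]; ring
  have e2 : gap (s, t) = l ^ p * gap (s / l, t / l) := by
    simp only [hgap]
    rw [key ((s + t) / 2), key s, key t, div_right_comm (s + t), add_div s t]; ring
  rw [e1, e2]
  have := mul_le_mul_of_nonneg_left (hC _ hunit) (Real.rpow_pos_of_pos hlpos p).le
  linarith

/-! ### Uniform convexity of energies -/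

section Convexity

variable {M : Type*} [MeasurableSpace M] {m : Measure M} {p : ℝ}
  {F : Submodule ℝ (LpSpace m p)} {E : LpSpace m p → ℝ}

lemma IsEnergyForm.map_smul (h : IsEnergyForm F E) (hp : 0 < p) (a : ℝ) {u : LpSpace m p}
    (hu : u ∈ F) : E (a • u) = |a| ^ p * E u := by
  have h1 := h.smul a u hu
  have h2 : (E (a • u) ^ (1 / p)) ^ p = (|a| * E u ^ (1 / p)) ^ p := by rw [h1]
  rw [Real.mul_rpow (abs_nonneg a) (Real.rpow_nonneg (h.nonneg u hu) _),
    ← Real.rpow_mul (h.nonneg u hu), ← Real.rpow_mul (h.nonneg _ (F.smul_mem a hu)),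
    one_div_mul_cancel hp.ne', Real.rpow_one, Real.rpow_one] at h2
  exact h2

lemma IsEnergyForm.map_sub_comm (h : IsEnergyForm F E) (hp : 0 < p) {u v : LpSpace m p}
    (hu : u ∈ F) (hv : v ∈ F) : E (u - v) = E (v - u) := by
  have := h.map_smul hp (-1) (F.sub_mem hv hu)
  simpa using this

lemma IsEnergyForm.midpoint_le (h : IsEnergyForm F E) (hp : 1 ≤ p) {u v : LpSpace m p}
    (hu : u ∈ F) (hv : v ∈ F) : E ((1 / 2 : ℝ) • (u + v)) ≤ (E u + E v) / 2 := by
  have hp0 : 0 < p := by linarith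
  have hpow : ∀ x : ℝ, 0 ≤ x → (x ^ (1 / p)) ^ p = x := fun x hx => by
    rw [← Real.rpow_mul hx, one_div_mul_cancel hp0.ne', Real.rpow_one]
  have hw := F.smul_mem (1 / 2 : ℝ) (F.add_mem hu hv)
  have h1 : E ((1 / 2 : ℝ) • (u + v)) ^ (1 / p) ≤ (E u ^ (1 / p) + E v ^ (1 / p)) / 2 := by
    rw [h.smul _ _ (F.add_mem hu hv), abs_of_pos (by norm_num)]
    linarith [h.add_le u hu v hv]
  calc E ((1 / 2 : ℝ) • (u + v)) = (E ((1 / 2 : ℝ) • (u + v)) ^ (1 / p)) ^ p :=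
        (hpow _ (h.nonneg _ hw)).symm
    _ ≤ ((E u ^ (1 / p) + E v ^ (1 / p)) / 2) ^ p :=
        Real.rpow_le_rpow (Real.rpow_nonneg (h.nonneg _ hw) _) h1 hp0.le
    _ ≤ ((E u ^ (1 / p)) ^ p + (E v ^ (1 / p)) ^ p) / 2 :=
        rpow_midpoint_le hp (Real.rpow_nonneg (h.nonneg u hu) _)
          (Real.rpow_nonneg (h.nonneg v hv) _)
    _ = _ := by rw [hpow _ (h.nonneg u hu), hpow _ (h.nonneg v hv)]

/-- Uniform convexity of `E` on `F`, in an additive form: the energy of a difference is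
controlled by the convexity gap at the midpoint, up to a small multiple of the energies. Unlike
the Clarkson inequality, this form visibly passes to sums and integrals, uniformly in `p`. -/
def UnifConvex (F : Submodule ℝ (LpSpace m p)) (E : LpSpace m p → ℝ) : Prop :=
  ∀ ε > 0, ∃ C : ℝ, 0 ≤ C ∧ ∀ u ∈ F, ∀ v ∈ F,
    E (u - v) ≤ ε * (E u + E v) + C * ((E u + E v) / 2 - E ((1 / 2 : ℝ) • (u + v)))

/-- The real-variable core of the case `p ≤ 2` of the Clarkson inequality, where `A` is the mean of
two energies, `c` the energy of the midpoint, `d` that of the half difference and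
`s = 1 / (p - 1)`. -/
lemma exists_le_add_mul_sub {s κ : ℝ} (hs : 1 ≤ s) (hκ : 0 < κ) (hκ1 : κ ≤ 1) :
    ∃ C : ℝ, 0 ≤ C ∧ ∀ A c d : ℝ, 0 ≤ A → 0 ≤ c → 0 ≤ d → c ≤ A → c ^ s + d ^ s ≤ A ^ s →
      d ≤ κ * A + C * (A - c) := by
  have hs0 : 0 < s := by linarith
  -- This `η` makes the Bernoulli bound `s * η * A ^ s` for `d ^ s` equal to `(κ * A) ^ s`.
  set η := κ ^ s / s with hη
  have hκs : 0 < κ ^ s := Real.rpow_pos_of_pos hκ s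
  have hηpos : 0 < η := by positivity
  have hη1 : η ≤ 1 := by
    rw [hη, div_le_one hs0]
    exact (Real.rpow_le_one hκ.le hκ1 hs0.le).trans hs
  refine ⟨1 / η, by positivity, fun A c d hA hc hd hcA h => ?_⟩
  have hdA : d ≤ A := by
    have : d ^ s ≤ A ^ s := by linarith [Real.rpow_nonneg hc s]
    exact (Real.rpow_le_rpow_iff hd hA hs0).1 this
  have hgap : 0 ≤ A - c := by linarith
  by_cases hcase : η * A ≤ A - c
  · have : A ≤ 1 / η * (A - c) := by rw [div_mul_eq_mul_div, le_div_iff₀ hηpos]; linarith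
    have : 0 ≤ κ * A := by positivity
    linarith
  · have hc' : (1 - η) * A ≤ c := by linarith
    -- Bernoulli's inequality bounds `(1 - η) ^ s` from below.
    have hB : 1 + s * (-η) ≤ (1 + -η) ^ s := one_add_mul_self_le_rpow_one_add (by linarith) hs
    have hcs : (1 - κ ^ s) * A ^ s ≤ c ^ s := by
      have hsη : s * η = κ ^ s := by rw [hη]; field_simp
      calc (1 - κ ^ s) * A ^ s ≤ (1 - η) ^ s * A ^ s := by
            gcongr
            rw [← sub_eq_add_neg] at hB
            linarith
        _ = ((1 - η) * A) ^ s := (Real.mul_rpow (by linarith) hA).symm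
        _ ≤ c ^ s := Real.rpow_le_rpow (mul_nonneg (by linarith) hA) hc' hs0.le
    have hds : d ^ s ≤ (κ * A) ^ s := by rw [Real.mul_rpow hκ.le hA]; linarith
    have := (Real.rpow_le_rpow_iff hd (by positivity) hs0).1 hds
    have : 0 ≤ 1 / η * (A - c) := by positivity
    linarith

lemma Clarkson.unifConvex (hC : Clarkson F E) (h : IsEnergyForm F E) (hp : 1 < p) :
    UnifConvex F E := by
  have hp0 : 0 < p := by linarith
  have h2p : (0 : ℝ) < 2 ^ p := by positivity
  intro ε hε
  rcases le_total 2 p with h2 | h2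
  · refine ⟨2 ^ p, h2p.le, fun u hu v hv => ?_⟩
    have hcl := (hC u hu v hv).2 h2
    have ha := h.nonneg u hu
    have hb := h.nonneg v hv
    have hmean := rpow_midpoint_le (r := p - 1) (by linarith)
      (Real.rpow_nonneg ha (1 / (p - 1))) (Real.rpow_nonneg hb (1 / (p - 1)))
    rw [← Real.rpow_mul ha, ← Real.rpow_mul hb, one_div_mul_cancel (by linarith : p - 1 ≠ 0),
      Real.rpow_one, Real.rpow_one, Real.div_rpow (by positivity) (by norm_num),
      div_le_iff₀ (by positivity)] at hmean
    have hpow : (2 : ℝ) ^ p = 2 * 2 ^ (p - 1) := by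
      rw [Real.rpow_sub_one (by norm_num)]; ring
    have hsum : E (u + v) = 2 ^ p * E ((1 / 2 : ℝ) • (u + v)) := by
      rw [h.map_smul hp0 _ (F.add_mem hu hv), abs_of_pos (by norm_num),
        Real.div_rpow (by norm_num) (by norm_num), Real.one_rpow]
      field_simp
    have : 0 ≤ ε * (E u + E v) := by positivity
    nlinarith
  · set s := 1 / (p - 1) with hs
    have hs1 : 1 ≤ s := by rw [hs, le_div_iff₀ (by linarith)]; linarith
    obtain ⟨C, hC0, hCb⟩ := exists_le_add_mul_sub hs1 (κ := min 1 (2 * ε / 2 ^ p))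
      (by positivity) (min_le_left _ _)
    refine ⟨2 ^ p * C, by positivity, fun u hu v hv => ?_⟩
    have hu' := F.smul_mem (1 / 2 : ℝ) (F.add_mem hu hv)
    have hv' := F.smul_mem (1 / 2 : ℝ) (F.sub_mem hu hv)
    have hcl := (hC _ hu' _ hv').1 h2
    have e1 : (1 / 2 : ℝ) • (u + v) + (1 / 2 : ℝ) • (u - v) = u := by module
    have e2 : (1 / 2 : ℝ) • (u + v) - (1 / 2 : ℝ) • (u - v) = v := by module
    rw [e1, e2] at hcl
    have hc := h.nonneg _ hu'
    have hd := h.nonneg _ hv'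
    have ha := h.nonneg u hu
    have hb := h.nonneg v hv
    have hA : 0 ≤ (E u + E v) / 2 := by positivity
    have hsub : E (u - v) = 2 ^ p * E ((1 / 2 : ℝ) • (u - v)) := by
      rw [h.map_smul hp0 _ (F.sub_mem hu hv), abs_of_pos (by norm_num),
        Real.div_rpow (by norm_num) (by norm_num), Real.one_rpow]
      field_simp
    have hpow : E ((1 / 2 : ℝ) • (u + v)) ^ s + E ((1 / 2 : ℝ) • (u - v)) ^ s
        ≤ ((E u + E v) / 2) ^ s := by
      have hx : 0 ≤ E ((1 / 2 : ℝ) • (u + v)) ^ s + E ((1 / 2 : ℝ) • (u - v)) ^ s := by positivity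
      have := Real.rpow_le_rpow (by positivity)
        ((le_div_iff₀' (by norm_num : (0 : ℝ) < 2)).2 hcl) (by linarith : 0 ≤ s)
      rwa [← Real.rpow_mul hx, hs, mul_one_div_cancel (by linarith : p - 1 ≠ 0),
        Real.rpow_one] at this
    have hfin := hCb _ _ _ hA hc hd (h.midpoint_le hp.le hu hv) hpow
    have hκ : min 1 (2 * ε / 2 ^ p) * ((E u + E v) / 2) ≤ 2 * ε / 2 ^ p * ((E u + E v) / 2) := by
      gcongr; exact min_le_right _ _
    rw [hsub]
    calc 2 ^ p * E ((1 / 2 : ℝ) • (u - v))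
        ≤ 2 ^ p * (2 * ε / 2 ^ p * ((E u + E v) / 2)
            + C * ((E u + E v) / 2 - E ((1 / 2 : ℝ) • (u + v)))) := by gcongr; linarith
      _ = _ := by field_simp

end Convexity

/-! ### The mixed form on continuous functions of compact support -/

section Jump

variable {M : Type*} [MeasurableSpace M] {p : ℝ}

lemma integrable_jump {j : Measure (OffDiag M)} {f : M → ℝ} (hf : Measurable f)
    (hj : jumpEnergy p j f ≠ ∞) :
    Integrable (fun q : OffDiag M => |f q.1.1 - f q.1.2| ^ p) j := by
  have hm : Measurable fun q : OffDiag M => |f q.1.1 - f q.1.2| ^ p := by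
    have h1 : Measurable fun q : OffDiag M => f q.1.1 :=
      hf.comp (measurable_fst.comp measurable_subtype_coe)
    have h2 : Measurable fun q : OffDiag M => f q.1.2 :=
      hf.comp (measurable_snd.comp measurable_subtype_coe)
    exact (continuous_abs.measurable.comp (h1.sub h2)).pow_const p
  refine (lintegral_ofReal_ne_top_iff_integrable hm.aestronglyMeasurable ?_).1 hj
  exact Eventually.of_forall fun q => Real.rpow_nonneg (abs_nonneg _) p

lemma toReal_jumpEnergy {j : Measure (OffDiag M)} {f : M → ℝ} (hf : Measurable f)
    (hj : jumpEnergy p j f ≠ ∞) :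
    (jumpEnergy p j f).toReal = ∫ q : OffDiag M, |f q.1.1 - f q.1.2| ^ p ∂j := by
  rw [integral_eq_lintegral_of_nonneg_ae
    (Eventually.of_forall fun q => Real.rpow_nonneg (abs_nonneg _) p)
    (integrable_jump hf hj).aestronglyMeasurable]
  rfl

lemma jumpEnergy_midpoint_le (hp : 1 < p) {j : Measure (OffDiag M)} {f g : M → ℝ}
    (hf : Measurable f) (hg : Measurable g) (hjf : jumpEnergy p j f ≠ ∞)
    (hjg : jumpEnergy p j g ≠ ∞) (hjm : jumpEnergy p j ((1 / 2 : ℝ) • (f + g)) ≠ ∞) :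
    (jumpEnergy p j ((1 / 2 : ℝ) • (f + g))).toReal ≤
      ((jumpEnergy p j f).toReal + (jumpEnergy p j g).toReal) / 2 := by
  have hm : Measurable ((1 / 2 : ℝ) • (f + g)) := (hf.add hg).const_smul _
  rw [toReal_jumpEnergy hf hjf, toReal_jumpEnergy hg hjg, toReal_jumpEnergy hm hjm,
    ← integral_add (integrable_jump hf hjf) (integrable_jump hg hjg), ← integral_div]
  refine integral_mono (integrable_jump hm hjm)
    (((integrable_jump hf hjf).add (integrable_jump hg hjg)).div_const 2) fun q => ?_
  have h := abs_rpow_midpoint_le hp (f q.1.1 - f q.1.2) (g q.1.1 - g q.1.2)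
  simp only [Pi.smul_apply, Pi.add_apply, smul_eq_mul]
  rwa [show 1 / 2 * (f q.1.1 + g q.1.1) - 1 / 2 * (f q.1.2 + g q.1.2) =
    (f q.1.1 - f q.1.2 + (g q.1.1 - g q.1.2)) / 2 by ring]

lemma exists_jumpEnergy_sub_le (hp : 1 < p) {ε : ℝ} (hε : 0 < ε) :
    ∃ C : ℝ, 0 ≤ C ∧ ∀ (j : Measure (OffDiag M)) (f g : M → ℝ), Measurable f → Measurable g →
      jumpEnergy p j f ≠ ∞ → jumpEnergy p j g ≠ ∞ → jumpEnergy p j (f - g) ≠ ∞ →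
      jumpEnergy p j ((1 / 2 : ℝ) • (f + g)) ≠ ∞ →
      (jumpEnergy p j (f - g)).toReal ≤
        ε * ((jumpEnergy p j f).toReal + (jumpEnergy p j g).toReal) +
        C * (((jumpEnergy p j f).toReal + (jumpEnergy p j g).toReal) / 2 -
          (jumpEnergy p j ((1 / 2 : ℝ) • (f + g))).toReal) := by
  obtain ⟨C, hC0, hC⟩ := exists_abs_sub_rpow_le hp hε
  refine ⟨C, hC0, fun j f g hf hg hjf hjg hjd hjm => ?_⟩
  have hm : Measurable ((1 / 2 : ℝ) • (f + g)) := (hf.add hg).const_smul _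
  have hif := integrable_jump hf hjf
  have hig := integrable_jump hg hjg
  have him := integrable_jump hm hjm
  have hsum : Integrable (fun q : OffDiag M =>
    |f q.1.1 - f q.1.2| ^ p + |g q.1.1 - g q.1.2| ^ p) j := hif.add hig
  have hgap := ((hsum.div_const 2).sub him).const_mul C
  simp only [Pi.sub_apply] at hgap
  rw [toReal_jumpEnergy hf hjf, toReal_jumpEnergy hg hjg, toReal_jumpEnergy hm hjm,
    toReal_jumpEnergy (hf.sub hg) hjd, ← integral_add hif hig, ← integral_const_mul,
    ← integral_div, ← integral_sub (hsum.div_const 2) him, ← integral_const_mul,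
    ← integral_add (hsum.const_mul ε) hgap]
  refine integral_mono (integrable_jump (hf.sub hg) hjd)
    ((hsum.const_mul ε).add hgap) fun q => ?_
  have h := hC (f q.1.1 - f q.1.2) (g q.1.1 - g q.1.2)
  simp only [Pi.smul_apply, Pi.add_apply, Pi.sub_apply, smul_eq_mul]
  rwa [show 1 / 2 * (f q.1.1 + g q.1.1) - 1 / 2 * (f q.1.2 + g q.1.2) =
    (f q.1.1 - f q.1.2 + (g q.1.1 - g q.1.2)) / 2 by ring,
    show f q.1.1 - g q.1.1 - (f q.1.2 - g q.1.2) = f q.1.1 - f q.1.2 - (g q.1.1 - g q.1.2) by ring]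

lemma jumpEnergy_comp_le (hp : 0 ≤ p) (j : Measure (OffDiag M)) {ψ : ℝ → ℝ}
    (hψ : LipschitzWith 1 ψ) (f : M → ℝ) : jumpEnergy p j (ψ ∘ f) ≤ jumpEnergy p j f := by
  refine lintegral_mono fun q => ENNReal.ofReal_le_ofReal ?_
  refine Real.rpow_le_rpow (abs_nonneg _) ?_ hp
  simpa [Real.dist_eq] using hψ.dist_le_mul (f q.1.1) (f q.1.2)

end Jump

section Mixed

variable {M : Type*} [MetricSpace M] [MeasurableSpace M]
  {m : Measure M} {p : ℝ} {F : Submodule ℝ (LpSpace m p)} {E : LpSpace m p → ℝ}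

lemma IsMixedForm.markovian_inf (hE : IsMixedForm F E) (hp : 0 ≤ p) :
    Markovian (F ⊓ CcLp m p) E := by
  obtain ⟨j, EL, -, -, hEL, -, -, hM, -⟩ := hE.exists_jump
  intro ψ hψ h0 u hu
  obtain ⟨hmem, hle⟩ := hM ψ hψ h0 u hu
  refine ⟨hmem, ?_⟩
  obtain ⟨f, hfc, hfs, huf⟩ := hu.2
  obtain ⟨hjf, ef⟩ := hEL u hu.1 f hfc hfs huf
  have hae : hψ.compLp h0 u =ᵐ[m] ψ ∘ f :=
    (hψ.coeFn_compLp h0 u).trans (huf.fun_comp ψ)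
  obtain ⟨-, ec⟩ := hEL _ hmem.1 (ψ ∘ f) (hψ.continuous.comp hfc) (hfs.comp_left h0) hae
  have hj := ENNReal.toReal_mono hjf (jumpEnergy_comp_le hp j hψ f)
  linarith

variable [BorelSpace M]

/-- On `F ∩ C_c(M)` the form is the sum of its strongly local part, uniformly convex by the Clarkson
inequality, and of its jump part, uniformly convex because `|x| ^ p` is. -/
lemma IsMixedForm.unifConvex (hE : IsMixedForm F E) (hp : 1 < p) :
    UnifConvex (F ⊓ CcLp m p) E := by
  obtain ⟨j, EL, -, -, hEL, hform, -, -, hCl⟩ := hE.exists_jump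
  intro ε hε
  obtain ⟨C₁, hC₁, h₁⟩ := hCl.unifConvex hform hp ε hε
  obtain ⟨C₂, hC₂, h₂⟩ := exists_jumpEnergy_sub_le (M := M) hp hε
  refine ⟨max C₁ C₂, le_max_of_le_left hC₁, fun u hu v hv => ?_⟩
  obtain ⟨f, hfc, hfs, huf⟩ := hu.2
  obtain ⟨g, hgc, hgs, hvg⟩ := hv.2
  obtain ⟨hjf, ef⟩ := hEL u hu.1 f hfc hfs huf
  obtain ⟨hjg, eg⟩ := hEL v hv.1 g hgc hgs hvg
  obtain ⟨hjd, ed⟩ := hEL (u - v) (F.sub_mem hu.1 hv.1) (f - g) (hfc.sub hgc) (hfs.sub hgs)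
    ((Lp.coeFn_sub u v).trans (huf.sub hvg))
  obtain ⟨hjm, em⟩ := hEL ((1 / 2 : ℝ) • (u + v)) (F.smul_mem _ (F.add_mem hu.1 hv.1))
    ((1 / 2 : ℝ) • (f + g)) ((hfc.add hgc).const_smul _)
    ((hfs.add hgs).smul_left (f := fun _ => (1 / 2 : ℝ)))
    ((Lp.coeFn_smul _ _).trans (((Lp.coeFn_add u v).trans (huf.add hvg)).const_smul _))
  have k₁ := h₁ u hu v hv
  have k₂ := h₂ j f g hfc.measurable hgc.measurable hjf hjg hjd hjm
  have g₁ := hform.midpoint_le hp.le hu hv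
  have g₂ := jumpEnergy_midpoint_le hp hfc.measurable hgc.measurable hjf hjg hjm
  have m₁ := mul_le_mul_of_nonneg_right (le_max_left C₁ C₂) (sub_nonneg.2 g₁)
  have m₂ := mul_le_mul_of_nonneg_right (le_max_right C₁ C₂) (sub_nonneg.2 g₂)
  rw [ef, eg, em] at m₁
  rw [ed, ef, eg, em] at k₁
  linarith

end Mixed

/-! ### Lower semicontinuity and the Markov property -/

section Closed

variable {M : Type*} [MeasurableSpace M] {m : Measure M} {p : ℝ}
  {F D : Submodule ℝ (LpSpace m p)} {E : LpSpace m p → ℝ}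

/-- Lower semicontinuity of a closed energy along `L^p`-convergent sequences of bounded energy.
Elements of nearly least energy in the convex hulls of the tails form a Cauchy sequence, by
uniform convexity, and converge to the same limit as the given sequence. -/
lemma IsEnergyForm.mem_and_le_of_tendsto [Fact (1 ≤ ENNReal.ofReal p)] (h : IsEnergyForm F E)
    (hp : 1 < p) (hcl : Closed F E) (hDF : D ≤ F) (hUC : UnifConvex D E)
    {v : ℕ → LpSpace m p} {w : LpSpace m p} {R : ℝ} (hv : ∀ n, v n ∈ D)
    (hlim : Tendsto v atTop (𝓝 w)) (hR : ∀ n, E (v n) ≤ R) : w ∈ F ∧ E w ≤ R := by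
  have hp0 : 0 < p := by linarith
  have hR0 : 0 ≤ R := (h.nonneg _ (hDF (hv 0))).trans (hR 0)
  set K : ℕ → Set (LpSpace m p) := fun n => convexHull ℝ (v '' Set.Ici n) with hK
  have hKD : ∀ n, K n ⊆ D := fun n => convexHull_min
    (by rintro _ ⟨k, -, rfl⟩; exact hv k) D.convex
  have hKmono : ∀ n k, n ≤ k → K k ⊆ K n := fun n k hnk =>
    convexHull_mono (Set.image_mono (Set.Ici_subset_Ici.2 hnk))
  have hvK : ∀ n, v n ∈ K n := fun n => subset_convexHull ℝ _ ⟨n, Set.mem_Ici.2 le_rfl, rfl⟩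
  have hKconv : ∀ n, Convex ℝ (K n) := fun n => convex_convexHull ℝ _
  have hbdd : ∀ n, BddBelow (E '' K n) := fun n =>
    ⟨0, by rintro _ ⟨x, hx, rfl⟩; exact h.nonneg x (hDF (hKD n hx))⟩
  have hne : ∀ n, (E '' K n).Nonempty := fun n => ⟨_, v n, hvK n, rfl⟩
  set d : ℕ → ℝ := fun n => sInf (E '' K n) with hd
  have hdle : ∀ n, ∀ x ∈ K n, d n ≤ E x := fun n x hx => csInf_le (hbdd n) ⟨x, hx, rfl⟩
  have hdR : ∀ n, d n ≤ R := fun n => (hdle n _ (hvK n)).trans (hR n)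
  have hdmono : Monotone d := fun n k hnk =>
    csInf_le_csInf (hbdd n) (hne k) (Set.image_mono (hKmono n k hnk))
  have hdlim : Tendsto d atTop (𝓝 (⨆ n, d n)) :=
    tendsto_atTop_ciSup hdmono ⟨R, by rintro _ ⟨n, rfl⟩; exact hdR n⟩
  set L := ⨆ n, d n with hL
  have hdL : ∀ n, d n ≤ L := fun n => le_ciSup (f := d) ⟨R, by rintro _ ⟨n, rfl⟩; exact hdR n⟩ n
  have hLR : L ≤ R := ciSup_le hdR
  have hex : ∀ n : ℕ, ∃ x ∈ K n, E x < d n + 1 / ((n : ℝ) + 1) := fun n => by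
    obtain ⟨_, ⟨x, hx, rfl⟩, hlt⟩ := exists_lt_of_csInf_lt (hne n)
      (show d n < d n + 1 / ((n : ℝ) + 1) by linarith [Nat.one_div_pos_of_nat (α := ℝ) (n := n)])
    exact ⟨x, hx, hlt⟩
  choose y hyK hyE using hex
  have hinv : ∀ N n : ℕ, N ≤ n → (1 : ℝ) / ((n : ℝ) + 1) ≤ 1 / ((N : ℝ) + 1) :=
    fun N n hNn => Nat.one_div_le_one_div hNn
  have hyD : ∀ n, y n ∈ D := fun n => hKD n (hyK n)
  have hyw : Tendsto y atTop (𝓝 w) := by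
    rw [Metric.tendsto_atTop] at hlim ⊢
    intro ε hε
    obtain ⟨N, hN⟩ := hlim ε hε
    refine ⟨N, fun n hn => ?_⟩
    have : K n ⊆ Metric.ball w ε := convexHull_min
      (by rintro _ ⟨k, hk, rfl⟩; exact hN k (hn.trans hk)) (convex_ball w ε)
    exact this (hyK n)
  have hEcauchy : ∀ ε > 0, ∃ N, ∀ n ≥ N, ∀ k ≥ N, E (y n - y k) < ε := by
    intro ε hε
    obtain ⟨C, hC0, hC⟩ := hUC (ε / (4 * (R + 1))) (by positivity)
    have hγ : Tendsto (fun N : ℕ => C * (L + 1 / ((N : ℝ) + 1) - d N)) atTop (𝓝 0) := by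
      have := ((tendsto_const_nhds (x := L)).add
        (tendsto_one_div_add_atTop_nhds_zero_nat (𝕜 := ℝ))).sub hdlim
      simpa using this.const_mul C
    obtain ⟨N, hN⟩ := (hγ.eventually (gt_mem_nhds (half_pos hε))).exists
    refine ⟨N, fun n hn k hk => ?_⟩
    have hbound : ∀ i ≥ N, E (y i) ≤ L + 1 / ((N : ℝ) + 1) := fun i hi => by
      linarith [hyE i, hinv N i hi, hdL i]
    have hone : (1 : ℝ) / ((N : ℝ) + 1) ≤ 1 := by simpa using hinv 0 N (Nat.zero_le N)
    have hmid : (1 / 2 : ℝ) • (y n + y k) ∈ K N := by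
      rw [smul_add]
      exact hKconv N (hKmono N n hn (hyK n)) (hKmono N k hk (hyK k)) (by norm_num) (by norm_num)
        (by norm_num)
    have h1 := hC _ (hyD n) _ (hyD k)
    have h2 := hdle N _ hmid
    have h3 : E (y n) + E (y k) ≤ 2 * (R + 1) := by linarith [hbound n hn, hbound k hk]
    have h4 : ε / (4 * (R + 1)) * (E (y n) + E (y k)) ≤ ε / 2 := by
      calc _ ≤ ε / (4 * (R + 1)) * (2 * (R + 1)) := by gcongr
        _ = ε / 2 := by field_simp; norm_num
    have h5 : C * ((E (y n) + E (y k)) / 2 - E ((1 / 2 : ℝ) • (y n + y k)))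
        ≤ C * (L + 1 / ((N : ℝ) + 1) - d N) := by
      gcongr
      linarith [hbound n hn, hbound k hk]
    linarith
  obtain ⟨w', hw'F, hw'⟩ := hcl y (fun n => hDF (hyD n)) (by
    intro ε hε
    obtain ⟨N₁, hN₁⟩ := hEcauchy (ε / 2) (half_pos hε)
    obtain ⟨N₂, hN₂⟩ := Metric.cauchySeq_iff.1 hyw.cauchySeq ((ε / 2) ^ (1 / p)) (by positivity)
    refine ⟨max N₁ N₂, fun n hn k hk => ?_⟩
    have a1 := hN₁ n (le_of_max_le_left hn) k (le_of_max_le_left hk)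
    have a2 := hN₂ n (le_of_max_le_right hn) k (le_of_max_le_right hk)
    rw [dist_eq_norm] at a2
    have a3 : ‖y n - y k‖ ^ p < ε / 2 := by
      have := Real.rpow_lt_rpow (norm_nonneg _) a2 hp0
      rwa [← Real.rpow_mul (half_pos hε).le, one_div_mul_cancel hp0.ne', Real.rpow_one] at this
    unfold E1
    linarith)
  have hsub0 : ∀ n, 0 ≤ E (y n - w') := fun n => h.nonneg _ (F.sub_mem (hDF (hyD n)) hw'F)
  have hEw' : Tendsto (fun n => E (y n - w')) atTop (𝓝 0) :=
    squeeze_zero hsub0 (fun n => le_add_of_nonneg_right (by positivity)) hw'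
  have hnorm : Tendsto (fun n => ‖y n - w'‖ ^ p) atTop (𝓝 0) :=
    squeeze_zero (fun n => by positivity) (fun n => le_add_of_nonneg_left (hsub0 n)) hw'
  have hyw' : Tendsto y atTop (𝓝 w') := by
    rw [tendsto_iff_norm_sub_tendsto_zero]
    have := hnorm.rpow_const (p := 1 / p) (Or.inr (by positivity))
    rw [Real.zero_rpow (by positivity)] at this
    refine this.congr fun n => ?_
    rw [← Real.rpow_mul (norm_nonneg _), mul_one_div_cancel hp0.ne', Real.rpow_one]
  obtain rfl : w = w' := tendsto_nhds_unique hyw hyw'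
  refine ⟨hw'F, ?_⟩
  have hkey : E w ^ (1 / p) ≤ R ^ (1 / p) := by
    have ht : Tendsto (fun n : ℕ => (R + 1 / ((n : ℝ) + 1)) ^ (1 / p) + E (y n - w) ^ (1 / p))
        atTop (𝓝 (R ^ (1 / p) + 0)) := by
      refine Tendsto.add ?_ ?_
      · have := (tendsto_const_nhds (x := R)).add
          (tendsto_one_div_add_atTop_nhds_zero_nat (𝕜 := ℝ))
        rw [add_zero] at this
        exact this.rpow_const (Or.inr (by positivity))
      · have := hEw'.rpow_const (p := 1 / p) (Or.inr (by positivity))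
        rwa [Real.zero_rpow (by positivity)] at this
    rw [add_zero] at ht
    refine ge_of_tendsto' ht fun n => ?_
    have hyF := hDF (hyD n)
    have htri := h.add_le (y n) hyF (w - y n) (F.sub_mem hw'F hyF)
    rw [add_sub_cancel, h.map_sub_comm hp0 hw'F hyF] at htri
    have : E (y n) ^ (1 / p) ≤ (R + 1 / ((n : ℝ) + 1)) ^ (1 / p) :=
      Real.rpow_le_rpow (h.nonneg _ hyF) (by linarith [hyE n, hdR n]) (by positivity)
    linarith
  exact (Real.rpow_le_rpow_iff (h.nonneg _ hw'F) hR0 (by positivity)).1 hkey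

end Closed

section Markov

variable {M : Type*} [MetricSpace M] [MeasurableSpace M] [BorelSpace M]
  {m : Measure M} {p : ℝ} {F : Submodule ℝ (LpSpace m p)} {E : LpSpace m p → ℝ}

/-- The Markov property passes from `F ∩ C_c(M)` to `F`, by density and lower semicontinuity. -/
theorem IsMixedForm.markovian (hE : IsMixedForm F E) (hp : 1 < p) : Markovian F E := by
  have hp0 : 0 < p := by linarith
  have : Fact (1 ≤ ENNReal.ofReal p) := ⟨by simpa using ENNReal.ofReal_le_ofReal hp.le⟩
  have h := hE.isEnergyForm
  intro ψ hψ h0 u hu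
  choose a haD ha using fun n : ℕ =>
    hE.regular.1 u hu (1 / ((n : ℝ) + 1)) Nat.one_div_pos_of_nat
  have hE1 : Tendsto (fun n => E1 E (u - a n)) atTop (𝓝 0) :=
    squeeze_zero (fun n => add_nonneg (h.nonneg _ (F.sub_mem hu (haD n).1)) (by positivity))
      (fun n => (ha n).le) tendsto_one_div_add_atTop_nhds_zero_nat
  have hsub0 : ∀ n, 0 ≤ E (u - a n) := fun n => h.nonneg _ (F.sub_mem hu (haD n).1)
  have hEa : Tendsto (fun n => E (u - a n)) atTop (𝓝 0) :=
    squeeze_zero hsub0 (fun n => le_add_of_nonneg_right (by positivity)) hE1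
  have hnorm : Tendsto (fun n => ‖u - a n‖ ^ p) atTop (𝓝 0) :=
    squeeze_zero (fun n => by positivity) (fun n => le_add_of_nonneg_left (hsub0 n)) hE1
  have hau : Tendsto a atTop (𝓝 u) := by
    rw [tendsto_iff_norm_sub_tendsto_zero]
    have := hnorm.rpow_const (p := 1 / p) (Or.inr (by positivity))
    rw [Real.zero_rpow (by positivity)] at this
    refine this.congr fun n => ?_
    rw [← Real.rpow_mul (norm_nonneg _), mul_one_div_cancel hp0.ne', Real.rpow_one, norm_sub_rev]
  have hlim : Tendsto (fun n => hψ.compLp h0 (a n)) atTop (𝓝 (hψ.compLp h0 u)) :=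
    ((hψ.continuous_compLp h0).tendsto u).comp hau
  have hMk := hE.markovian_inf hp0.le
  -- The energies of the approximants are eventually below any number above `E u`.
  have hroot : ∀ r > E u, ∀ᶠ n in atTop, E (a n) ≤ r := by
    intro r hr
    have hu0 := h.nonneg u hu
    have ht : Tendsto (fun n => E u ^ (1 / p) + E (u - a n) ^ (1 / p)) atTop
        (𝓝 (E u ^ (1 / p) + 0)) := by
      refine tendsto_const_nhds.add ?_
      have := hEa.rpow_const (p := 1 / p) (Or.inr (by positivity))
      rwa [Real.zero_rpow (by positivity)] at this
    rw [add_zero] at ht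
    filter_upwards [ht.eventually (gt_mem_nhds (Real.rpow_lt_rpow hu0 hr
      (by positivity : 0 < 1 / p)))] with n hn
    have htri := h.add_le u hu (a n - u) (F.sub_mem (haD n).1 hu)
    rw [add_sub_cancel, h.map_sub_comm hp0 (haD n).1 hu] at htri
    exact (Real.rpow_le_rpow_iff (h.nonneg _ (haD n).1) (hu0.trans hr.le)
      (by positivity : 0 < 1 / p)).1 (htri.trans hn.le)
  have key : ∀ r > E u, hψ.compLp h0 u ∈ F ∧ E (hψ.compLp h0 u) ≤ r := by
    intro r hr
    obtain ⟨N, hN⟩ := eventually_atTop.1 (hroot r hr)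
    exact h.mem_and_le_of_tendsto hp hE.closed inf_le_left (hE.unifConvex hp)
      (v := fun n => hψ.compLp h0 (a (n + N))) (fun n => (hMk ψ hψ h0 _ (haD _)).1)
      (hlim.comp (tendsto_add_atTop_nat N))
      fun n => (hMk ψ hψ h0 _ (haD _)).2.trans (hN _ (Nat.le_add_left N n))
  exact ⟨(key (E u + 1) (by linarith)).1, le_of_forall_gt_imp_ge_of_dense fun r hr => (key r hr).2⟩

end Markov

/-! ### Weak-type estimates -/

/-- A self-improving bound for a distribution function. With `q = p / (1 - ν)` the quantity
`h t = t ^ q * b t` satisfies `h (2 t) ≤ 2 ^ q * A * h t ^ ν`; since it is bounded on each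
interval `(0, T]`, its supremum there is at most the fixed point of this recursion. -/
lemma rpow_mul_le_of_doubling {b : ℝ → ℝ} {V A p ν : ℝ} (hp : 0 < p) (hν1 : ν < 1) (hν : 0 < ν)
    (hA : 0 < A) (hb0 : ∀ t, 0 ≤ b t) (hbV : ∀ t, b t ≤ V)
    (h : ∀ t > 0, t ^ p * b (2 * t) ≤ A * b t ^ ν) {t : ℝ} (ht : 0 < t) :
    t ^ (p / (1 - ν)) * b t ≤ (2 ^ (p / (1 - ν)) * A) ^ (1 / (1 - ν)) := by
  have h1ν : 0 < 1 - ν := by linarith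
  set q := p / (1 - ν) with hq
  have hq0 : 0 < q := by positivity
  have hqν : q = p + q * ν := by rw [hq]; field_simp; ring
  set H : Set ℝ := (fun s => s ^ q * b s) '' Set.Ioc 0 t with hH
  have hbdd : BddAbove H := by
    refine ⟨t ^ q * V, ?_⟩
    rintro _ ⟨s, hs, rfl⟩
    exact mul_le_mul (Real.rpow_le_rpow hs.1.le hs.2 hq0.le) (hbV s) (hb0 s) (by positivity)
  have hmem : t ^ q * b t ∈ H := ⟨t, ⟨ht, le_rfl⟩, rfl⟩
  set S := sSup H with hS
  have hS0 : 0 ≤ S := le_trans (mul_nonneg (by positivity) (hb0 t)) (le_csSup hbdd hmem)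
  have hrec : S ≤ 2 ^ q * A * S ^ ν := by
    refine csSup_le ⟨_, hmem⟩ ?_
    rintro _ ⟨s, hs, rfl⟩
    have hs2 : 0 < s / 2 := half_pos hs.1
    have hle : (s / 2) ^ q * b (s / 2) ≤ S :=
      le_csSup hbdd ⟨s / 2, ⟨hs2, by linarith [hs.1, hs.2]⟩, rfl⟩
    have h' := h (s / 2) hs2
    rw [mul_div_cancel₀ s two_ne_zero] at h'
    have hsq : s ^ q = 2 ^ q * ((s / 2) ^ (q * ν) * (s / 2) ^ p) := by
      rw [← Real.rpow_add hs2, add_comm, ← hqν, ← Real.mul_rpow (by norm_num) hs2.le,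
        mul_div_cancel₀ s two_ne_zero]
    calc s ^ q * b s = 2 ^ q * (s / 2) ^ (q * ν) * ((s / 2) ^ p * b s) := by rw [hsq]; ring
      _ ≤ 2 ^ q * (s / 2) ^ (q * ν) * (A * b (s / 2) ^ ν) := by gcongr
      _ = 2 ^ q * A * ((s / 2) ^ q * b (s / 2)) ^ ν := by
        rw [Real.mul_rpow (by positivity) (hb0 _), ← Real.rpow_mul hs2.le]; ring
      _ ≤ 2 ^ q * A * S ^ ν := by
        have := mul_nonneg (by positivity : 0 ≤ (s / 2) ^ q) (hb0 (s / 2))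
        gcongr
  refine (le_csSup hbdd hmem).trans ?_
  rcases hS0.eq_or_lt with h0 | hSpos
  · rw [← hS, ← h0]; positivity
  · have hpow : S ^ (1 - ν) ≤ 2 ^ q * A := by
      rw [Real.rpow_sub hSpos, Real.rpow_one, div_le_iff₀ (by positivity)]
      exact hrec
    have := Real.rpow_le_rpow (by positivity) hpow (by positivity : 0 ≤ 1 / (1 - ν))
    rwa [← Real.rpow_mul hS0, mul_one_div_cancel h1ν.ne', Real.rpow_one] at this

/-- On a finite measure space, weak `L^q` embeds into `L^r` for `r < q`. The layer cake integral
is split at the height where the trivial and the weak-type bound agree. -/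
lemma lintegral_rpow_le_of_weak {α : Type*} [MeasurableSpace α] {μ : Measure α} {f : α → ℝ}
    (hf : AEMeasurable f μ) {V D q r : ℝ} (hV : 0 < V) (hD : 0 < D) (hr : 0 < r) (hrq : r < q)
    (hμ : μ Set.univ ≤ ENNReal.ofReal V)
    (hw : ∀ t > 0, t ^ q * (μ {x | t < |f x|}).toReal ≤ D) :
    ∫⁻ x, ENNReal.ofReal (|f x| ^ r) ∂μ ≤
      ENNReal.ofReal (q / (q - r) * V ^ (1 - r / q) * D ^ (r / q)) := by
  have hq : 0 < q := hr.trans hrq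
  have hqr : 0 < q - r := by linarith
  have hfin : ∀ s : Set α, μ s ≠ ∞ := fun s =>
    ((measure_mono (Set.subset_univ s)).trans hμ).trans_lt ENNReal.ofReal_lt_top |>.ne
  set l := (D / V) ^ (1 / q) with hl
  have hlpos : 0 < l := by positivity
  have hlq : l ^ q = D / V := by
    rw [hl, ← Real.rpow_mul (by positivity), one_div_mul_cancel hq.ne', Real.rpow_one]
  rw [lintegral_rpow_eq_lintegral_meas_lt_mul μ (Eventually.of_forall fun x => abs_nonneg (f x))
    (continuous_abs.measurable.comp_aemeasurable hf) hr, ← Set.Ioc_union_Ioi_eq_Ioi hlpos.le,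
    lintegral_union measurableSet_Ioi (Set.Ioc_disjoint_Ioi le_rfl)]
  have hint1 : IntegrableOn (fun t : ℝ => V * t ^ (r - 1)) (Set.Ioc 0 l) :=
    (((intervalIntegral.intervalIntegrable_rpow' (by linarith)).1).const_mul V)
  have h1 : ∫⁻ t in Set.Ioc 0 l, μ {x | t < |f x|} * ENNReal.ofReal (t ^ (r - 1)) ≤
      ENNReal.ofReal (V * (l ^ r / r)) := by
    calc _ ≤ ∫⁻ t in Set.Ioc 0 l, ENNReal.ofReal (V * t ^ (r - 1)) := by
          refine setLIntegral_mono' measurableSet_Ioc fun t ht => ?_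
          rw [ENNReal.ofReal_mul hV.le]
          gcongr
          exact (measure_mono (Set.subset_univ _)).trans hμ
      _ = ENNReal.ofReal (∫ t in Set.Ioc 0 l, V * t ^ (r - 1)) := by
          rw [ofReal_integral_eq_lintegral_ofReal hint1]
          refine (ae_restrict_iff' measurableSet_Ioc).2 (Eventually.of_forall fun t ht => ?_)
          exact mul_nonneg hV.le (Real.rpow_nonneg ht.1.le _)
      _ = _ := by
          rw [integral_const_mul, ← intervalIntegral.integral_of_le hlpos.le,
            integral_rpow (Or.inl (by linarith)), sub_add_cancel, Real.zero_rpow hr.ne', sub_zero]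
  have hint2 : IntegrableOn (fun t : ℝ => D * t ^ (r - 1 - q)) (Set.Ioi l) :=
    (integrableOn_Ioi_rpow_of_lt (by linarith) hlpos).const_mul D
  have h2 : ∫⁻ t in Set.Ioi l, μ {x | t < |f x|} * ENNReal.ofReal (t ^ (r - 1)) ≤
      ENNReal.ofReal (D * (l ^ (r - q) / (q - r))) := by
    calc _ ≤ ∫⁻ t in Set.Ioi l, ENNReal.ofReal (D * t ^ (r - 1 - q)) := by
          refine setLIntegral_mono' measurableSet_Ioi fun t ht => ?_
          have ht0 : 0 < t := hlpos.trans ht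
          rw [← ENNReal.ofReal_toReal (hfin {x | t < |f x|}),
            ← ENNReal.ofReal_mul ENNReal.toReal_nonneg]
          refine ENNReal.ofReal_le_ofReal ?_
          have hb : (μ {x | t < |f x|}).toReal ≤ D / t ^ q := by
            rw [le_div_iff₀' (by positivity)]; exact hw t ht0
          calc _ ≤ D / t ^ q * t ^ (r - 1) := by gcongr
            _ = _ := by rw [Real.rpow_sub ht0 (r - 1) q]; ring
      _ = ENNReal.ofReal (∫ t in Set.Ioi l, D * t ^ (r - 1 - q)) := by
          rw [ofReal_integral_eq_lintegral_ofReal hint2]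
          refine (ae_restrict_iff' measurableSet_Ioi).2 (Eventually.of_forall fun t ht => ?_)
          exact mul_nonneg hD.le (Real.rpow_nonneg (hlpos.trans ht).le _)
      _ = _ := by
          rw [integral_const_mul, integral_Ioi_rpow_of_lt (by linarith) hlpos,
            show r - 1 - q + 1 = -(q - r) by ring, neg_div_neg_eq, neg_sub]
  refine (mul_le_mul_right (add_le_add h1 h2) _).trans_eq ?_
  rw [← ENNReal.ofReal_add (by positivity) (by positivity), ← ENNReal.ofReal_mul hr.le]
  congr 1
  have e1 : D * l ^ (r - q) = V * l ^ r := by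
    rw [Real.rpow_sub hlpos, hlq]; field_simp
  have e2 : l ^ r = D ^ (r / q) / V ^ (r / q) := by
    rw [hl, ← Real.rpow_mul (by positivity), one_div_mul_eq_div, Real.div_rpow hD.le hV.le]
  rw [mul_div_assoc', mul_div_assoc', e1, e2, Real.rpow_sub hV, Real.rpow_one]
  field_simp
  ring

/-! ### Lebesgue norms with a real exponent -/

section Norms

variable {α : Type*} [MeasurableSpace α] {μ : Measure α}

lemma ofReal_abs_rpow (x : ℝ) {s : ℝ} (hs : 0 ≤ s) :
    ENNReal.ofReal (|x| ^ s) = ‖x‖ₑ ^ s := by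
  rw [← ENNReal.ofReal_rpow_of_nonneg (abs_nonneg x) hs, Real.enorm_eq_ofReal_abs]

lemma eLpNorm_ofReal_eq {s : ℝ} (hs : 0 < s) (f : α → ℝ) :
    eLpNorm f (ENNReal.ofReal s) μ = (∫⁻ x, ‖f x‖ₑ ^ s ∂μ) ^ (1 / s) := by
  rw [eLpNorm_eq_lintegral_rpow_enorm_toReal (by simpa using hs) ENNReal.ofReal_ne_top,
    ENNReal.toReal_ofReal hs.le]

lemma eLpNorm_ofReal_rpow {s : ℝ} (hs : 0 < s) (f : α → ℝ) :
    eLpNorm f (ENNReal.ofReal s) μ ^ s = ∫⁻ x, ‖f x‖ₑ ^ s ∂μ := by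
  rw [eLpNorm_ofReal_eq hs, ← ENNReal.rpow_mul, one_div_mul_cancel hs.ne', ENNReal.rpow_one]

lemma lintegral_enorm_rpow_lt_top {p : ℝ} (hp : 0 < p) (u : LpSpace μ p) :
    ∫⁻ x, ‖u x‖ₑ ^ p ∂μ < ∞ := by
  rw [← eLpNorm_ofReal_rpow hp]
  exact ENNReal.rpow_lt_top_of_nonneg hp.le (Lp.eLpNorm_ne_top u)

lemma ofReal_norm_rpow {p : ℝ} (hp : 0 < p) (u : LpSpace μ p) :
    ENNReal.ofReal (‖u‖ ^ p) = ∫⁻ x, ‖u x‖ₑ ^ p ∂μ := by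
  rw [← eLpNorm_ofReal_rpow hp, Lp.norm_def,
    ← ENNReal.ofReal_rpow_of_nonneg ENNReal.toReal_nonneg hp.le,
    ENNReal.ofReal_toReal (Lp.eLpNorm_ne_top u)]

/-- Chebyshev's inequality. -/
lemma rpow_mul_meas_le_lintegral {p : ℝ} (hp : 0 < p) {f : α → ℝ} (hf : AEMeasurable f μ)
    {t : ℝ} (ht : 0 ≤ t) :
    ENNReal.ofReal (t ^ p) * μ {x | t ≤ |f x|} ≤ ∫⁻ x, ‖f x‖ₑ ^ p ∂μ := by
  refine le_trans ?_ (mul_meas_ge_le_lintegral₀ (hf.enorm.pow_const p) (ENNReal.ofReal (t ^ p)))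
  gcongr with x
  intro hx
  rw [← ofReal_abs_rpow _ hp.le]
  exact ENNReal.ofReal_le_ofReal (Real.rpow_le_rpow ht hx hp.le)

end Norms

/-! ### Capacity and the spaces `F(Ω)` -/

section Capacity

variable {M : Type*} [MeasurableSpace M]
  {m : Measure M} {p : ℝ} {F : Submodule ℝ (LpSpace m p)} {E : LpSpace m p → ℝ}

/-- Capacity dominates measure, since `‖u‖ ^ p` is a part of `E_1(u)`. -/
lemma meas_le_capOpen (hp : 0 < p) (hE : ∀ u ∈ F, 0 ≤ E u) (G : Set M) :
    m G ≤ capOpen F E G := by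
  refine le_iInf₂ fun u hu => ?_
  calc m G ≤ ∫⁻ x in G, ‖u x‖ₑ ^ p ∂m := by
        rw [← setLIntegral_one]
        refine lintegral_mono_ae ?_
        filter_upwards [hu.2] with x hx
        rw [← ofReal_abs_rpow _ hp.le, ENNReal.one_le_ofReal]
        exact Real.one_le_rpow (hx.trans (le_abs_self _)) hp.le
    _ ≤ ∫⁻ x, ‖u x‖ₑ ^ p ∂m := setLIntegral_le_lintegral _ _
    _ = ENNReal.ofReal (‖u‖ ^ p) := (ofReal_norm_rpow hp u).symm
    _ ≤ _ := ENNReal.ofReal_le_ofReal (le_add_of_nonneg_left (hE u hu.1))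

variable [MetricSpace M]

lemma cap_mono {A B : Set M} (h : A ⊆ B) : cap F E A ≤ cap F E B :=
  biInf_mono fun _ hG => ⟨hG.1, h.trans hG.2⟩

lemma meas_le_cap (hp : 0 < p) (hE : ∀ u ∈ F, 0 ≤ E u) (A : Set M) : m A ≤ cap F E A :=
  le_iInf₂ fun _ hG => (measure_mono hG.2).trans (meas_le_capOpen hp hE _)

lemma ae_eq_zero_of_mem_Dom (hp : 0 < p) (hE : ∀ u ∈ F, 0 ≤ E u) {Ω : Set M}
    {u : LpSpace m p} (hu : u ∈ Dom F E Ω) : ∀ᵐ x ∂m, x ∉ Ω → u x = 0 := by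
  obtain ⟨-, f, -, huf, N, -, -, hN, hf⟩ := hu
  have hN0 : ∀ᵐ x ∂m, x ∉ N :=
    measure_eq_zero_iff_ae_notMem.1 (le_antisymm ((meas_le_cap hp hE N).trans hN.le) bot_le)
  filter_upwards [huf, hN0] with x hx hxN hxΩ
  rw [hx, hf x ⟨hxΩ, hxN⟩]

variable [BorelSpace M]

lemma Dom_mono {Ω Ω' : Set M} (h : Ω ⊆ Ω') (hΩ' : IsOpen Ω') : Dom F E Ω ⊆ Dom F E Ω' := by
  rintro u ⟨huF, f, hqc, huf, N, -, hNm, hN, hf⟩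
  refine ⟨huF, f, hqc, huf, N ∩ Ω'ᶜ, Set.inter_subset_right,
    hNm.inter hΩ'.measurableSet.compl,
    le_antisymm ((cap_mono Set.inter_subset_left).trans hN.le) bot_le, fun x hx => ?_⟩
  exact hf x ⟨fun hxΩ => hx.1 (h hxΩ), fun hxN => hx.2 ⟨hxN, hx.1⟩⟩

lemma setLIntegral_eq_of_mem_Dom (hp : 0 < p) (hE : ∀ u ∈ F, 0 ≤ E u) {Ω Ω' : Set M}
    (hΩ : IsOpen Ω) (hΩ' : IsOpen Ω') (h : Ω ⊆ Ω')
    {u : LpSpace m p} (hu : u ∈ Dom F E Ω) {s : ℝ} (hs : 0 < s) :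
    ∫⁻ x in Ω', ‖u x‖ₑ ^ s ∂m = ∫⁻ x in Ω, ‖u x‖ₑ ^ s ∂m := by
  rw [← lintegral_indicator hΩ'.measurableSet, ← lintegral_indicator hΩ.measurableSet]
  refine lintegral_congr_ae ?_
  filter_upwards [ae_eq_zero_of_mem_Dom hp hE hu] with x hx
  by_cases hxΩ : x ∈ Ω
  · simp [hxΩ, h hxΩ]
  · simp [hxΩ, hx hxΩ, hs]

/-! ### Truncation -/

/-- The truncation `s ↦ (|s| - t)⁺`. -/
def trunc (t s : ℝ) : ℝ := max (|s| - t) 0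

lemma lipschitzWith_trunc (t : ℝ) : LipschitzWith 1 (trunc t) := by
  refine LipschitzWith.max_const ?_ 0
  simpa using lipschitzWith_one_norm.sub (LipschitzWith.const (α := ℝ) t)

lemma trunc_zero {t : ℝ} (ht : 0 ≤ t) : trunc t 0 = 0 := by simp [trunc, ht]

/-- The truncation of `u ∈ F(B)` at height `t` belongs to `F(Ω)` for an open set `Ω ⊆ B` that is
barely larger than `{|u| > t}`. If `f` is a quasi-continuous version of `u`, then `{|f| > t}`
becomes open after an open set `G` of small capacity, hence of small measure, is added. -/
lemma exists_isOpen_trunc_mem_Dom (hp : 0 < p) (hE : ∀ u ∈ F, 0 ≤ E u) (hM : Markovian F E)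
    {B : Set M} (hB : IsOpen B) {u : LpSpace m p} (hu : u ∈ Dom F E B) {t : ℝ} (ht : 0 ≤ t)
    {ε : ℝ≥0∞} (hε : 0 < ε) :
    ∃ Ω : Set M, IsOpen Ω ∧ Ω ⊆ B ∧ m Ω ≤ m.restrict B {x | t < |u x|} + ε ∧
      (lipschitzWith_trunc t).compLp (trunc_zero ht) u ∈ Dom F E Ω ∧
      ENNReal.ofReal (t ^ p) * m.restrict B {x | 2 * t < |u x|} ≤
        ∫⁻ x in Ω, ‖(lipschitzWith_trunc t).compLp (trunc_zero ht) u x‖ₑ ^ p ∂m := by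
  obtain ⟨huF, f, hqc, huf, N, hNB, hNm, hN, hf⟩ := hu
  obtain ⟨G, hGo, hGc, hfG⟩ := hqc ε hε
  set w := (lipschitzWith_trunc t).compLp (trunc_zero ht) u with hw
  have hwf : w =ᵐ[m] trunc t ∘ f :=
    ((lipschitzWith_trunc t).coeFn_compLp (trunc_zero ht) u).trans (huf.fun_comp (trunc t))
  set S : Set M := {x | t < |f x|} with hS
  have hSG : IsOpen (S ∪ G) := by
    have hcl : IsClosed (Gᶜ ∩ f ⁻¹' {s | |s| ≤ t}) :=
      hfG.preimage_isClosed_of_isClosed hGo.isClosed_compl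
        (isClosed_le continuous_abs continuous_const)
    convert hcl.isOpen_compl using 1
    ext x
    simp only [hS, Set.mem_union, Set.mem_ofPred_eq, Set.mem_compl_iff, Set.mem_inter_iff,
      Set.mem_preimage, not_and_or, not_not, not_le]
    exact or_comm
  have hae : ∀ s : ℝ, m.restrict B {x | s < |u x|} = m.restrict B {x | s < |f x|} := fun s =>
    measure_congr (by
      filter_upwards [ae_restrict_of_ae huf] with x hx
      simp only [eq_iff_iff]
      change s < |u x| ↔ s < |f x|
      rw [hx])
  refine ⟨(S ∪ G) ∩ B, hSG.inter hB, Set.inter_subset_right, ?_, ?_, ?_⟩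
  · rw [Set.union_inter_distrib_right, hae, Measure.restrict_apply' hB.measurableSet]
    refine (measure_union_le _ _).trans (add_le_add le_rfl ?_)
    exact (measure_mono Set.inter_subset_left).trans
      ((meas_le_capOpen hp hE G).trans hGc.le)
  · refine ⟨(hM _ (lipschitzWith_trunc t) (trunc_zero ht) u huF).1, trunc t ∘ f, ?_, hwf, ?_⟩
    · intro δ hδ
      obtain ⟨G', hGo', hGc', hfG'⟩ := hqc δ hδ
      exact ⟨G', hGo', hGc', (lipschitzWith_trunc t).continuous.comp_continuousOn hfG'⟩
    · refine ⟨N, hNB.trans (Set.compl_subset_compl.2 Set.inter_subset_right), hNm, hN, ?_⟩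
      rintro x ⟨hxΩ, hxN⟩
      by_cases hxB : x ∈ B
      · have hxS : ¬ t < |f x| := fun h => hxΩ ⟨Or.inl h, hxB⟩
        simp only [Function.comp, trunc]
        exact max_eq_right (by linarith)
      · simp [hf x ⟨hxB, hxN⟩, trunc_zero ht]
  · refine le_trans ?_ (rpow_mul_meas_le_lintegral hp
      (Lp.aestronglyMeasurable w).aemeasurable.restrict ht)
    rw [hae]
    gcongr ENNReal.ofReal (t ^ p) * ?_
    rw [Measure.restrict_apply' hB.measurableSet,
      Measure.restrict_apply' (hSG.inter hB).measurableSet]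
    refine measure_mono_ae ?_
    filter_upwards [hwf] with x hx hxm
    obtain ⟨hx2, hxB⟩ := hxm
    have hx2 : 2 * t < |f x| := hx2
    refine ⟨?_, Or.inl (show t < |f x| by linarith), hxB⟩
    change t ≤ |w x|
    rw [hx]
    simp only [Function.comp, trunc]
    exact le_trans (by linarith) ((le_max_left (|f x| - t) 0).trans (le_abs_self _))

end Capacity

/-! ### From Faber–Krahn to Sobolev -/

section Inequalities

variable {M : Type*} [MetricSpace M]

lemma IsScale.pos {W : M → ℝ → ℝ} (hW : IsScale W) (x : M) {r : ℝ} (hr : 0 < r) : 0 < W x r := by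
  have := hW.strictMonoOn x (Set.mem_Ici.2 le_rfl) (Set.mem_Ici.2 hr.le) hr
  rwa [hW.zero] at this

variable [MeasurableSpace M] {m : Measure M} {p : ℝ} {F : Submodule ℝ (LpSpace m p)}
  {E : LpSpace m p → ℝ}
  {W : M → ℝ → ℝ} {Rbar : ℝ≥0∞}

lemma div_rpow_le_of_exponent_le {a b : ℝ≥0∞} (hab : a ≤ b) {ν' ν : ℝ} (hν' : 0 < ν') (h : ν' ≤ ν) :
    (b / a) ^ ν' ≤ (b / a) ^ ν := by
  rcases eq_or_ne a ∞ with rfl | ha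
  · simp [ENNReal.zero_rpow_of_pos hν']
  rcases eq_or_ne a 0 with rfl | ha0
  · rcases eq_or_ne b 0 with rfl | hb
    · simp [ENNReal.zero_rpow_of_pos hν']
    · rw [ENNReal.div_zero hb]
      simp [ENNReal.top_rpow_of_pos hν', ENNReal.top_rpow_of_pos (hν'.trans_le h)]
  · refine ENNReal.rpow_le_rpow_of_exponent_le ?_ h
    rwa [ENNReal.le_div_iff_mul_le (Or.inl ha0) (Or.inl ha), one_mul]

/-- The exponent in the Faber–Krahn inequality may be decreased, since `m(Ω) ≤ m(B)`. -/
lemma FaberKrahn.exists_lt_one (h : FaberKrahn F E W Rbar) :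
    ∃ σ C ν : ℝ, 0 < σ ∧ σ ≤ 1 ∧ 0 < C ∧ 0 < ν ∧ ν < 1 ∧
    ∀ (x : M) (r : ℝ), 0 < r → ENNReal.ofReal r < ENNReal.ofReal σ * Rbar →
    ∀ Ω : Set M, IsOpen Ω → Ω.Nonempty → Ω ⊆ Metric.ball x r →
    ∀ u ∈ Dom F E Ω,
      ENNReal.ofReal (C / W x r) * (m (Metric.ball x r) / m Ω) ^ ν *
          eLpNorm u (ENNReal.ofReal p) (m.restrict Ω) ^ p
        ≤ ENNReal.ofReal (E u) := by
  obtain ⟨σ, C, ν, hσ, hσ1, hC, hν, h⟩ := h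
  refine ⟨σ, C, min ν (1 / 2), hσ, hσ1, hC, by positivity,
    (min_le_right _ _).trans_lt (by norm_num), fun x r hr hrR Ω hΩ hne hΩB u hu => ?_⟩
  refine le_trans ?_ (h x r hr hrR Ω hΩ hne hΩB u hu)
  gcongr ENNReal.ofReal (C / W x r) * ?_ * _
  exact div_rpow_le_of_exponent_le (measure_mono (μ := m) hΩB) (by positivity) (min_le_left _ _)

variable [BorelSpace M]

/-- The Faber–Krahn inequality for truncations, as a relation between the measures of two
superlevel sets. -/
lemma meas_superlevel_le (hp : 0 < p) (hE : ∀ u ∈ F, 0 ≤ E u) (hM : Markovian F E)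
    {B : Set M} (hB : IsOpen B) {c ν : ℝ} (hν : 0 < ν)
    (hFK : ∀ Ω : Set M, IsOpen Ω → Ω.Nonempty → Ω ⊆ B → ∀ u ∈ Dom F E Ω,
      ENNReal.ofReal c * (m B / m Ω) ^ ν * eLpNorm u (ENNReal.ofReal p) (m.restrict Ω) ^ p
        ≤ ENNReal.ofReal (E u))
    {u : LpSpace m p} (hu : u ∈ Dom F E B) {t : ℝ} (ht : 0 ≤ t) {ε : ℝ≥0∞} (hε : 0 < ε) :
    ENNReal.ofReal c * (m B / (m.restrict B {x | t < |u x|} + ε)) ^ ν *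
      (ENNReal.ofReal (t ^ p) * m.restrict B {x | 2 * t < |u x|}) ≤ ENNReal.ofReal (E u) := by
  obtain ⟨Ω, hΩ, hΩB, hmΩ, hw, hle⟩ := exists_isOpen_trunc_mem_Dom hp hE hM hB hu ht hε
  set w := (lipschitzWith_trunc t).compLp (trunc_zero ht) u with hwdef
  rcases Ω.eq_empty_or_nonempty with rfl | hne
  · rw [Measure.restrict_empty, lintegral_zero_measure] at hle
    rw [le_antisymm hle bot_le]
    simp
  · calc _ ≤ ENNReal.ofReal c * (m B / m Ω) ^ ν *
          eLpNorm w (ENNReal.ofReal p) (m.restrict Ω) ^ p := by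
          rw [eLpNorm_ofReal_rpow hp]
          gcongr
      _ ≤ ENNReal.ofReal (E w) := hFK Ω hΩ hne hΩB w hw
      _ ≤ _ := ENNReal.ofReal_le_ofReal (hM _ _ _ u hu.1).2

omit [MetricSpace M] [BorelSpace M] in
lemma meas_superlevel_lt_top (hp : 0 < p) (u : LpSpace m p) (B : Set M) {t : ℝ} (ht : 0 < t) :
    m.restrict B {x | t < |u x|} < ∞ := by
  have h1 := rpow_mul_meas_le_lintegral hp (Lp.aestronglyMeasurable u).aemeasurable ht.le
  have h2 : m {x | t ≤ |u x|} < ∞ := by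
    refine ENNReal.lt_top_of_mul_ne_top_right
      (h1.trans_lt (lintegral_enorm_rpow_lt_top hp u)).ne ?_
    simpa using Real.rpow_pos_of_pos ht p
  refine lt_of_le_of_lt ?_ h2
  exact (Measure.restrict_apply_le _ _).trans
    (measure_mono fun x (hx : t < |u x|) => (show t ≤ |u x| from hx.le))

/-- The bound of the `L ^ r` norm on one ball `B` of positive finite measure `V`, for `r` below the
critical exponent `p / (1 - ν)`. The measures of the superlevel sets of `u` satisfy the recursion of
`rpow_mul_le_of_doubling`, once the auxiliary `δ` has tended to zero. -/
lemma lintegral_rpow_le_of_faberKrahn (hp : 0 < p) (hE : ∀ u ∈ F, 0 ≤ E u) (hM : Markovian F E)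
    {B : Set M} (hB : IsOpen B) {c ν V : ℝ} (hc : 0 < c) (hν : 0 < ν) (hν1 : ν < 1)
    (hV : 0 < V) (hmB : m B = ENNReal.ofReal V)
    (hFK : ∀ Ω : Set M, IsOpen Ω → Ω.Nonempty → Ω ⊆ B → ∀ u ∈ Dom F E Ω,
      ENNReal.ofReal c * (m B / m Ω) ^ ν * eLpNorm u (ENNReal.ofReal p) (m.restrict Ω) ^ p
        ≤ ENNReal.ofReal (E u))
    {u : LpSpace m p} (hu : u ∈ Dom F E B) {e : ℝ} (he : E u < e) {r q : ℝ} (hr0 : 0 < r)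
    (hq : q = p / (1 - ν)) (hrq : r < q) :
    ∫⁻ x in B, ENNReal.ofReal (|u x| ^ r) ∂m ≤
      ENNReal.ofReal (q / (q - r) * V ^ (1 - r / q) *
        ((2 ^ q * (e / (c * V ^ ν))) ^ (1 / (1 - ν))) ^ (r / q)) := by
  have he0 : 0 < e := (hE u hu.1).trans_lt he
  set b : ℝ → ℝ := fun t => (m.restrict B {x | t < |u x|}).toReal with hb
  have hle : ∀ t, m.restrict B {x | t < |u x|} ≤ ENNReal.ofReal V := fun t => by
    rw [← hmB]; exact (measure_mono (Set.subset_univ _)).trans_eq (Measure.restrict_apply_univ B)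
  have hfin : ∀ t, m.restrict B {x | t < |u x|} = ENNReal.ofReal (b t) := fun t =>
    (ENNReal.ofReal_toReal ((hle t).trans_lt ENNReal.ofReal_lt_top).ne).symm
  have hb0 : ∀ t, 0 ≤ b t := fun t => ENNReal.toReal_nonneg
  have hbV : ∀ t, b t ≤ V := fun t => ENNReal.toReal_le_of_le_ofReal hV.le (hle t)
  have hstep : ∀ t > 0, t ^ p * b (2 * t) ≤ e / (c * V ^ ν) * b t ^ ν := by
    intro t ht
    have hδ : ∀ δ > 0, t ^ p * b (2 * t) ≤ e / (c * V ^ ν) * (b t + δ) ^ ν := by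
      intro δ hδ
      have hbδ : 0 < b t + δ := by linarith [hb0 t]
      have h := meas_superlevel_le hp hE hM hB hν hFK hu ht.le (ENNReal.ofReal_pos.2 hδ)
      rw [hfin t, hfin (2 * t), hmB, ← ENNReal.ofReal_add (hb0 t) hδ.le,
        ← ENNReal.ofReal_div_of_pos hbδ, ENNReal.ofReal_rpow_of_nonneg (by positivity) hν.le,
        ← ENNReal.ofReal_mul hc.le, ← ENNReal.ofReal_mul (by positivity),
        ← ENNReal.ofReal_mul (by positivity), ENNReal.ofReal_le_ofReal_iff (hE u hu.1),
        Real.div_rpow hV.le hbδ.le] at h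
      have h' := h.trans he.le
      have hpow : 0 < (b t + δ) ^ ν := by positivity
      rw [div_mul_eq_mul_div, le_div_iff₀ (by positivity)]
      calc t ^ p * b (2 * t) * (c * V ^ ν)
          = c * (V ^ ν / (b t + δ) ^ ν) * (t ^ p * b (2 * t)) * (b t + δ) ^ ν := by
            field_simp
        _ ≤ _ := by gcongr
    have hlim : Tendsto (fun δ : ℝ => e / (c * V ^ ν) * (b t + δ) ^ ν) (𝓝[>] 0)
        (𝓝 (e / (c * V ^ ν) * (b t + 0) ^ ν)) := by
      have : Continuous fun δ : ℝ => e / (c * V ^ ν) * (b t + δ) ^ ν :=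
        continuous_const.mul
          ((continuous_const.add continuous_id).rpow_const fun _ => Or.inr hν.le)
      exact (this.tendsto 0).mono_left nhdsWithin_le_nhds
    rw [add_zero] at hlim
    exact ge_of_tendsto hlim (eventually_nhdsWithin_of_forall hδ)
  refine lintegral_rpow_le_of_weak (Lp.aestronglyMeasurable u).aemeasurable.restrict hV
    (by positivity) hr0 hrq (by rw [Measure.restrict_apply_univ, hmB]) fun t ht => ?_
  have := rpow_mul_le_of_doubling hp hν1 hν (by positivity) hb0 hbV hstep ht
  rwa [← hq] at this

/-- On a ball of infinite measure, the Faber–Krahn inequality forces `F(B) = 0`. -/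
lemma ae_eq_zero_of_faberKrahn (hp : 0 < p) (hE : ∀ u ∈ F, 0 ≤ E u) (hM : Markovian F E)
    {B : Set M} (hB : IsOpen B) {c ν : ℝ} (hc : 0 < c) (hν : 0 < ν) (hmB : m B = ∞)
    (hFK : ∀ Ω : Set M, IsOpen Ω → Ω.Nonempty → Ω ⊆ B → ∀ u ∈ Dom F E Ω,
      ENNReal.ofReal c * (m B / m Ω) ^ ν * eLpNorm u (ENNReal.ofReal p) (m.restrict Ω) ^ p
        ≤ ENNReal.ofReal (E u))
    {u : LpSpace m p} (hu : u ∈ Dom F E B) : u =ᵐ[m.restrict B] 0 := by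
  have hzero : ∀ t > 0, m.restrict B {x | 2 * t < |u x|} = 0 := by
    intro t ht
    have h := meas_superlevel_le hp hE hM hB hν hFK hu ht.le one_pos
    have hfin : m.restrict B {x | t < |u x|} + 1 ≠ ∞ :=
      ENNReal.add_ne_top.2 ⟨(meas_superlevel_lt_top hp u B ht).ne, ENNReal.one_ne_top⟩
    rw [hmB, ENNReal.top_div_of_ne_top hfin, ENNReal.top_rpow_of_pos hν,
      ENNReal.mul_top (by simpa using hc)] at h
    by_contra hne
    have htp : ENNReal.ofReal (t ^ p) ≠ 0 := by simpa using Real.rpow_pos_of_pos ht p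
    rw [ENNReal.top_mul (mul_ne_zero htp hne), top_le_iff] at h
    exact ENNReal.ofReal_ne_top h
  have hall : ∀ᵐ x ∂m.restrict B, ∀ n : ℕ, |u x| ≤ 2 * (1 / ((n : ℝ) + 1)) := by
    refine ae_all_iff.2 fun n => ?_
    filter_upwards [measure_eq_zero_iff_ae_notMem.1
      (hzero _ (Nat.one_div_pos_of_nat (α := ℝ) (n := n)))] with x hx
    exact not_lt.1 hx
  filter_upwards [hall] with x hx
  have hlim : Tendsto (fun n : ℕ => 2 * (1 / ((n : ℝ) + 1))) atTop (𝓝 (2 * 0)) :=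
    tendsto_one_div_add_atTop_nhds_zero_nat.const_mul 2
  rw [mul_zero] at hlim
  exact abs_nonpos_iff.1 (ge_of_tendsto' hlim hx)

/-- The Faber–Krahn inequality with exponent `ν < 1` bounds `u` in weak `L ^ (p / (1 - ν))`; halving
`ν` leaves room to pass from the weak to the strong norm on a ball of finite measure. -/
theorem FaberKrahn.sobolev (hp : 0 < p) (hE : ∀ u ∈ F, 0 ≤ E u) (hM : Markovian F E)
    (hW : IsScale W) (h : FaberKrahn F E W Rbar) : Sobolev F E W Rbar := by
  obtain ⟨σ, C, ν, hσ, hσ1, hC, hν, hν1, h⟩ := h.exists_lt_one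
  have h1ν : 0 < 1 - ν := by linarith
  have h1ν' : 0 < 1 - ν / 2 := by linarith
  set q := p / (1 - ν) with hq
  set r := p / (1 - ν / 2) with hr
  have hr0 : 0 < r := by positivity
  have hrq : r < q := div_lt_div_of_pos_left hp h1ν (by linarith)
  have hq0 : 0 < q := by positivity
  set K := q / (q - r) with hK
  have hK0 : 0 < K := div_pos hq0 (by linarith)
  have hrq' : r / q * (1 - ν / 2) = 1 - ν := by
    rw [hr, hq, div_div_div_cancel_left' _ _ hp.ne', div_mul_cancel₀ _ h1ν'.ne']
  refine ⟨σ, C / (K ^ (1 - ν / 2) * 2 ^ q), ν / 2, hσ, hσ1, by positivity, by positivity,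
    by linarith, fun x s hs hsR u hu => ?_⟩
  have hWp := hW.pos x hs
  have hFK := h x s hs hsR
  set B := Metric.ball x s with hB
  have hBo : IsOpen B := Metric.isOpen_ball
  rcases eq_or_ne (m B) ∞ with htop | htop
  · have hu0 := ae_eq_zero_of_faberKrahn hp hE hM hBo (by positivity) hν htop hFK hu
    rw [eLpNorm_congr_ae hu0, eLpNorm_zero, ENNReal.zero_rpow_of_pos hp, mul_zero]
    exact bot_le
  rcases eq_or_ne (m B) 0 with h0 | h0
  · rw [h0, ENNReal.zero_rpow_of_pos (by positivity)]
    simp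
  set V := (m B).toReal with hV
  have hVpos : 0 < V := ENNReal.toReal_pos h0 htop
  have hmB : m B = ENNReal.ofReal V := (ENNReal.ofReal_toReal htop).symm
  -- A number `e > E u` replaces the energy, which may vanish.
  refine le_of_forall_gt_imp_ge_of_dense fun e' he' => ?_
  rcases eq_or_ne e' ∞ with rfl | hetop
  · exact le_top
  have he : E u < e'.toReal := (ENNReal.ofReal_lt_iff_lt_toReal (hE u hu.1) hetop).1 he'
  set e := e'.toReal with hedef
  have he0 : 0 < e := (hE u hu.1).trans_lt he
  have hI := lintegral_rpow_le_of_faberKrahn hp hE hM hBo (by positivity : 0 < C / W x s) hν hν1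
    hVpos hmB hFK hu he hr0 hq hrq
  simp only [ofReal_abs_rpow _ hr0.le] at hI
  have hN : eLpNorm u (ENNReal.ofReal r) (m.restrict B) ^ p =
      (∫⁻ y in B, ‖u y‖ₑ ^ r ∂m) ^ (1 - ν / 2) := by
    rw [eLpNorm_ofReal_eq hr0, ← ENNReal.rpow_mul]
    congr 1
    rw [hr]; field_simp
  rw [hN, hmB, ENNReal.ofReal_rpow_of_pos hVpos, ← ENNReal.ofReal_mul (by positivity)]
  refine (mul_le_mul_right (ENNReal.rpow_le_rpow hI h1ν'.le) _).trans ?_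
  have hqr : 0 < q - r := by linarith
  rw [ENNReal.ofReal_rpow_of_nonneg (by positivity) h1ν'.le, ← ENNReal.ofReal_mul (by positivity),
    ← ENNReal.ofReal_toReal hetop, ← hedef]
  refine ENNReal.ofReal_le_ofReal (le_of_eq ?_)
  rw [← hK, Real.mul_rpow (by positivity) (by positivity), Real.mul_rpow hK0.le (by positivity),
    ← Real.rpow_mul hVpos.le, ← Real.rpow_mul (by positivity), ← Real.rpow_mul (by positivity),
    hrq', one_div_mul_cancel h1ν.ne', Real.rpow_one, sub_mul, one_mul,
    hrq']
  -- The powers of `V` cancel.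
  have hVV : V ^ (ν / 2) * V ^ (1 - ν / 2 - (1 - ν)) = V ^ ν := by
    rw [← Real.rpow_add hVpos]; congr 1; ring
  calc _ = C / (K ^ (1 - ν / 2) * 2 ^ q) / W x s * (V ^ (ν / 2) * V ^ (1 - ν / 2 - (1 - ν))) *
        (K ^ (1 - ν / 2) * (2 ^ q * (e / (C / W x s * V ^ ν)))) := by ring
    _ = e := by rw [hVV]; field_simp

/-! ### From Sobolev to the Sobolev-type inequality and back to Faber–Krahn -/

omit [BorelSpace M] in
theorem Sobolev.sobolevType (hp : 0 < p) (hW : IsScale W) (h : Sobolev F E W Rbar) :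
    SobolevType F E W Rbar := by
  obtain ⟨σ, C, ν, hσ, hσ1, hC, hν, hν1, h⟩ := h
  have h1ν : 0 < 1 - ν := by linarith
  refine ⟨σ, 1 / C, ν, hσ, hσ1, by positivity, hν, fun x s hs hsR u hu => ?_⟩
  have hWp := hW.pos x hs
  have hS := h x s hs hsR u hu
  set B := Metric.ball x s with hB
  rcases eq_or_ne (m B) 0 with h0 | h0
  · simp [Measure.restrict_eq_zero.2 h0]
  simp only [ofReal_abs_rpow _ hp.le, ofReal_abs_rpow _ (by positivity : 0 ≤ p * (1 + ν))]
  have hum : AEMeasurable (fun y => ‖u y‖ₑ) (m.restrict B) :=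
    (Lp.aestronglyMeasurable u).aemeasurable.enorm.restrict
  -- Hölder's inequality, from `p * (1 + ν) = p / (1 - ν) * (1 - ν) + p * ν`.
  have hHolder := ENNReal.lintegral_mul_norm_pow_le (hum.pow_const (p / (1 - ν)))
    (hum.pow_const p) h1ν.le hν.le (by ring)
  have hpt : ∀ y, (‖u y‖ₑ ^ (p / (1 - ν))) ^ (1 - ν) * (‖u y‖ₑ ^ p) ^ ν =
      ‖u y‖ₑ ^ (p * (1 + ν)) := fun y => by
    rw [← ENNReal.rpow_mul, ← ENNReal.rpow_mul, div_mul_cancel₀ p h1ν.ne',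
      ← ENNReal.rpow_add_of_nonneg _ _ hp.le (by positivity)]
    congr 1; ring
  simp only [hpt] at hHolder
  refine hHolder.trans ?_
  gcongr
  have hN : eLpNorm u (ENNReal.ofReal (p / (1 - ν))) (m.restrict B) ^ p =
      (∫⁻ y in B, ‖u y‖ₑ ^ (p / (1 - ν)) ∂m) ^ (1 - ν) := by
    rw [eLpNorm_ofReal_eq (by positivity), ← ENNReal.rpow_mul]
    congr 1; field_simp
  rw [hN] at hS
  have hc : ENNReal.ofReal (C / W x s) ≠ 0 := by simpa using div_pos hC hWp
  have hVne : m B ^ ν ≠ 0 := by simp [ENNReal.rpow_eq_zero_iff, h0, hν.not_gt]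
  have hinv : ENNReal.ofReal (1 / C * W x s) = (ENNReal.ofReal (C / W x s))⁻¹ := by
    rw [← ENNReal.ofReal_inv_of_pos (by positivity)]
    congr 1; field_simp
  rw [mul_comm] at hS
  refine ((ENNReal.le_div_iff_mul_le (Or.inl (mul_ne_zero hc hVne))
    (Or.inr ENNReal.ofReal_ne_top)).2 hS).trans_eq ?_
  rw [hinv, ENNReal.div_eq_inv_mul, ENNReal.div_eq_inv_mul,
    ENNReal.mul_inv (Or.inl hc) (Or.inl ENNReal.ofReal_ne_top), mul_comm (m B ^ ν)⁻¹]

/-- Hölder's inequality on `Ω`; the integrals over the ball reduce to integrals over `Ω`, because a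
function of `F(Ω)` vanishes almost everywhere outside `Ω`. -/
theorem SobolevType.faberKrahn (hp : 0 < p) (hE : ∀ u ∈ F, 0 ≤ E u) (hW : IsScale W)
    (h : SobolevType F E W Rbar) : FaberKrahn F E W Rbar := by
  obtain ⟨σ, C, ν, hσ, hσ1, hC, hν, h⟩ := h
  refine ⟨σ, 1 / C, ν, hσ, hσ1, by positivity, hν, fun x s hs hsR Ω hΩ hne hΩB u hu => ?_⟩
  have hWp := hW.pos x hs
  have hS := h x s hs hsR u (Dom_mono hΩB Metric.isOpen_ball hu)
  set B := Metric.ball x s with hB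
  have hpν : 0 < p * (1 + ν) := by positivity
  simp only [ofReal_abs_rpow _ hp.le, ofReal_abs_rpow _ hpν.le] at hS
  rw [setLIntegral_eq_of_mem_Dom hp hE hΩ Metric.isOpen_ball hΩB hu hp,
    setLIntegral_eq_of_mem_Dom hp hE hΩ Metric.isOpen_ball hΩB hu hpν] at hS
  rw [eLpNorm_ofReal_rpow hp]
  set Y := ∫⁻ y in Ω, ‖u y‖ₑ ^ p ∂m with hY
  have hYtop : Y ≠ ∞ :=
    ((setLIntegral_le_lintegral _ _).trans_lt (lintegral_enorm_rpow_lt_top hp u)).ne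
  rcases eq_or_ne Y 0 with hY0 | hY0
  · simp [hY0]
  rcases eq_or_ne (m Ω) ∞ with htop | htop
  · simp [htop, ENNReal.zero_rpow_of_pos hν]
  have hΩ0 : m Ω ≠ 0 := fun h0 => hY0 (by simp [hY, Measure.restrict_eq_zero.2 h0])
  have hB0 : m B ≠ 0 := fun h0 => hΩ0 (measure_mono_null hΩB h0)
  have hum : AEMeasurable (fun y => ‖u y‖ₑ) (m.restrict Ω) :=
    (Lp.aestronglyMeasurable u).aemeasurable.enorm.restrict
  have h1ν : 0 < 1 + ν := by linarith
  have hHolder : Y ^ (1 + ν) ≤ (∫⁻ y in Ω, ‖u y‖ₑ ^ (p * (1 + ν)) ∂m) * m Ω ^ ν := by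
    have := ENNReal.lintegral_mul_norm_pow_le (hum.pow_const (p * (1 + ν)))
      (aemeasurable_const (b := (1 : ℝ≥0∞))) (p := 1 / (1 + ν)) (q := ν / (1 + ν))
      (by positivity) (by positivity) (by field_simp)
    have hpt : ∀ y, (‖u y‖ₑ ^ (p * (1 + ν))) ^ (1 / (1 + ν)) * (1 : ℝ≥0∞) ^ (ν / (1 + ν)) =
        ‖u y‖ₑ ^ p := fun y => by
      rw [← ENNReal.rpow_mul, ENNReal.one_rpow, mul_one]
      congr 1; field_simp
    simp only [hpt, lintegral_one, Measure.restrict_apply_univ] at this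
    have h2 := ENNReal.rpow_le_rpow this h1ν.le
    rwa [ENNReal.mul_rpow_of_nonneg _ _ h1ν.le, ← ENNReal.rpow_mul, ← ENNReal.rpow_mul,
      one_div_mul_cancel h1ν.ne', div_mul_cancel₀ ν h1ν.ne', ENNReal.rpow_one] at h2
  have hYν0 : Y ^ ν ≠ 0 := by simp [ENNReal.rpow_eq_zero_iff, hY0, hν.not_gt]
  have hYνtop : Y ^ ν ≠ ∞ := ENNReal.rpow_ne_top_of_nonneg hν.le hYtop
  have hmain : Y ≤ ENNReal.ofReal (C * W x s) / m B ^ ν * ENNReal.ofReal (E u) * m Ω ^ ν := by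
    refine (ENNReal.mul_le_mul_iff_left hYν0 hYνtop).1 ?_
    calc Y * Y ^ ν = Y ^ (1 + ν) := by
          rw [ENNReal.rpow_add_of_nonneg _ _ zero_le_one hν.le, ENNReal.rpow_one]
      _ ≤ _ := hHolder
      _ ≤ ENNReal.ofReal (C * W x s) / m B ^ ν * ENNReal.ofReal (E u) * Y ^ ν * m Ω ^ ν := by
          gcongr
      _ = _ := by ring
  have hBtop : m B ≠ ∞ := by
    intro hBt
    refine hY0 (le_antisymm (hmain.trans_eq ?_) bot_le)
    simp [hBt, ENNReal.top_rpow_of_pos hν]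
  have hBν0 : m B ^ ν ≠ 0 := by simp [ENNReal.rpow_eq_zero_iff, hB0, hν.not_gt]
  have hBνtop : m B ^ ν ≠ ∞ := ENNReal.rpow_ne_top_of_nonneg hν.le hBtop
  have hΩν0 : m Ω ^ ν ≠ 0 := by simp [ENNReal.rpow_eq_zero_iff, hΩ0, hν.not_gt]
  have hΩνtop : m Ω ^ ν ≠ ∞ := ENNReal.rpow_ne_top_of_nonneg hν.le htop
  have hcc : ENNReal.ofReal (1 / C / W x s) * ENNReal.ofReal (C * W x s) = 1 := by
    rw [← ENNReal.ofReal_mul (by positivity), ← ENNReal.ofReal_one]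
    congr 1; field_simp
  calc ENNReal.ofReal (1 / C / W x s) * (m B / m Ω) ^ ν * Y
      ≤ ENNReal.ofReal (1 / C / W x s) * (m B / m Ω) ^ ν *
        (ENNReal.ofReal (C * W x s) / m B ^ ν * ENNReal.ofReal (E u) * m Ω ^ ν) := by gcongr
    _ = ENNReal.ofReal (1 / C / W x s) * ENNReal.ofReal (C * W x s) *
        (m B ^ ν * (m B ^ ν)⁻¹) * (m Ω ^ ν * (m Ω ^ ν)⁻¹) * ENNReal.ofReal (E u) := by
        rw [ENNReal.div_rpow_of_nonneg _ _ hν.le]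
        simp only [div_eq_mul_inv (G := ℝ≥0∞)]
        ring
    _ = ENNReal.ofReal (E u) := by
        rw [hcc, ENNReal.mul_inv_cancel hBν0 hBνtop, ENNReal.mul_inv_cancel hΩν0 hΩνtop]
        simp

end Inequalities

end PEnergy

theorem theorem3p6 {M : Type*} [MetricSpace M] [CompleteSpace M]
    [TopologicalSpace.SeparableSpace M] [MeasurableSpace M] [BorelSpace M]
    (m : MeasureTheory.Measure M) [m.Regular] (p : ℝ) (hp : 1 < p)
    (F : Submodule ℝ (PEnergy.LpSpace m p)) (E : PEnergy.LpSpace m p → ℝ)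
    (hE : PEnergy.IsMixedForm F E)
    (Rbar : ENNReal) (hR0 : 0 < Rbar) (hR : Rbar ≤ Metric.ediam (Set.univ : Set M))
    (W : M → ℝ → ℝ) (hW : PEnergy.IsScale W) :
    (PEnergy.FaberKrahn F E W Rbar ↔ PEnergy.Sobolev F E W Rbar) ∧
    (PEnergy.Sobolev F E W Rbar ↔ PEnergy.SobolevType F E W Rbar) := by
  have hp0 : 0 < p := by linarith
  have hnn := hE.isEnergyForm.nonneg
  have h1 : PEnergy.FaberKrahn F E W Rbar → PEnergy.Sobolev F E W Rbar :=
    fun h => h.sobolev hp0 hnn (hE.markovian hp) hW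
  have h2 : PEnergy.Sobolev F E W Rbar → PEnergy.SobolevType F E W Rbar :=
    fun h => h.sobolevType hp0 hW
  have h3 : PEnergy.SobolevType F E W Rbar → PEnergy.FaberKrahn F E W Rbar :=
    fun h => h.faberKrahn hp0 hnn hW
  exact ⟨⟨h1, fun h => h3 (h2 h)⟩, ⟨h2, fun h => h1 (h3 h)⟩⟩
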